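/- Let $a>0$, $d>0$, $n_1>1$, and let $\gamma_0:[0,d]^2\to\mathbb R$ be a Lipschitz symmetric function that is the kernel of a nonnegative operator on $L^2(0,d)$. Put $\theta=\sqrt{1-1/n_1^2}$, $$S_0=\int_0^d\!\int_0^d\gamma_0(x_1,x_2)\cos\big(\tfrac{\pi}{d}x_1\big)\cos\big(\tfrac{\pi}{d}x_2\big)\,dx_1dx_2,\qquad a_0=\frac{\pi^2S_0}{2a\,n_1^4d^4\theta^2},$$ $$a_\infty(u)=\frac{a_0}{1-\big(1-\frac{\pi^2}{a^2d^2}\big)(\theta u)^2}\quad(u\in[0,1]),$$ and assume $S_0>0$. Let $$\mathcal D=\Big\{\psi\in C^\infty([0,1];\mathbb R):\ \|\psi\|_{L^2(0,1)}=1,\ \psi'(0)=0,\ \psi(1)=0\Big\},\qquad \Lambda_\infty=\inf_{\psi\in\mathcal D}\int_0^1a_\infty(v)\,\psi'(v)^2\,dv .$$ For $\varphi\in L^2(0,1)$, a solution of the diffusion problem with initial value $\varphi$ is a real function $\mathcal T_\varphi(z,u)$, $z\ge0$, $u\in[0,1]$, such that $\mathcal T_\varphi$ and $\partial_u\mathcal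 T_\varphi$ are continuous on $(0,\infty)\times[0,1]$, the derivatives $\partial_z\mathcal T_\varphi$ and $\partial_u(a_\infty\partial_u\mathcal T_\varphi)$ exist on $(0,\infty)\times(0,1)$, with $\partial_z\mathcal T_\varphi$ continuous there, and $$\partial_z\mathcal T_\varphi=\partial_u\big(a_\infty\,\partial_u\mathcal T_\varphi\big)\ \text{ on }(0,\infty)\times(0,1),\qquad \partial_u\mathcal T_\varphi(z,0)=0,\quad \mathcal T_\varphi(z,1)=0\quad(z>0),$$ $\mathcal T_\varphi(0,\cdot)=\varphi$ almost everywhere, and $\mathcal T_\varphi(z,\cdot)\to\varphi$ in $L^2(0,1)$ as $z\to0^+$. Then $\Lambda_\infty>0$, and for every $\varphi\in L^2(0,1)\setminus\{0\}$ with $\varphi\ge0$ almost everywhere the diffusion problem with initial value $\varphi$ has a solution, and every solution $\mathcal T_\varphi$ satisfies, for every $u\in[0,1)$: $\mathcal T_\varphi(L,u)>0$ for all sufficiently large $L$, and $$\lim_{L\to+\infty}\frac1L\ln\big[\mathcal T_\varphi(L,u)\big]=-\Lambda_\infty .$$ -/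

import Mathlib

open Set Filter Topology MeasureTheory
open scoped ContDiff

noncomputable section

/-- Covariance function of the transverse inhomogeneities on the section `[0, d]`: a Lipschitz
symmetric kernel on `[0, d] × [0, d]` whose integral operator on `L²(0, d)` is nonnegative. -/
structure IsTransverseCovariance (d : ℝ) (γ₀ : ℝ → ℝ → ℝ) : Prop where
  lipschitz : ∃ K, LipschitzOnWith K (fun p : ℝ × ℝ => γ₀ p.1 p.2) (Icc 0 d ×ˢ Icc 0 d)
  symm : ∀ x ∈ Icc 0 d, ∀ y ∈ Icc 0 d, γ₀ x y = γ₀ y x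
  nonneg : ∀ ψ : ℝ → ℝ, MemLp ψ 2 (volume.restrict (Icc 0 d)) →
    0 ≤ ∫ x in (0 : ℝ)..d, ∫ y in (0 : ℝ)..d, γ₀ x y * ψ x * ψ y

/-- `S₀ = ∫₀ᵈ ∫₀ᵈ γ₀(x₁, x₂) cos(π x₁ / d) cos(π x₂ / d) dx₁ dx₂`. -/
def spectralS₀ (d : ℝ) (γ₀ : ℝ → ℝ → ℝ) : ℝ :=
  ∫ x₁ in (0 : ℝ)..d, ∫ x₂ in (0 : ℝ)..d,
    γ₀ x₁ x₂ * Real.cos (Real.pi / d * x₁) * Real.cos (Real.pi / d * x₂)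

/-- `θ = √(1 - 1 / n₁²)`. -/
def indexTheta (n₁ : ℝ) : ℝ := Real.sqrt (1 - 1 / n₁ ^ 2)

/-- `a₀ = π² S₀ / (2 a n₁⁴ d⁴ θ²)`. -/
def diffusionA₀ (a d n₁ : ℝ) (γ₀ : ℝ → ℝ → ℝ) : ℝ :=
  Real.pi ^ 2 * spectralS₀ d γ₀ / (2 * a * n₁ ^ 4 * d ^ 4 * indexTheta n₁ ^ 2)

/-- `a_∞(u) = a₀ / (1 - (1 - π² / (a² d²)) (θ u)²)`. -/
def diffusionCoeff (a d n₁ : ℝ) (γ₀ : ℝ → ℝ → ℝ) (u : ℝ) : ℝ :=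
  diffusionA₀ a d n₁ γ₀ /
    (1 - (1 - Real.pi ^ 2 / (a ^ 2 * d ^ 2)) * (indexTheta n₁ * u) ^ 2)

/-- The derivative of a function on `[0, 1]`, one-sided at the two end points. -/
def derivUnit (f : ℝ → ℝ) (u : ℝ) : ℝ := derivWithin f (Icc 0 1) u

/-- Lebesgue measure on the interval `(0, 1)`. -/
def unitVolume : Measure ℝ := volume.restrict (Ioo 0 1)

/-- `T` is a (classical) solution on `(0, ∞) × [0, 1]` of
`∂T/∂z = ∂/∂u (A(u) ∂T/∂u)`, `∂T/∂u (z, 0) = 0`, `T (z, 1) = 0`, `T (0, ·) = φ`,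
the initial value in `L²(0, 1)` being attained in `L²(0, 1)`. The function and its `u`-derivative
are continuous up to the boundary, the derivatives in the equation exist in the interior and
are continuous there. -/
structure IsDiffusionSolution (A φ : ℝ → ℝ) (T : ℝ → ℝ → ℝ) : Prop where
  continuousOn : ContinuousOn (fun p : ℝ × ℝ => T p.1 p.2) (Ioi 0 ×ˢ Icc 0 1)
  differentiable_u : ∀ z, 0 < z → DifferentiableOn ℝ (T z) (Icc 0 1)
  continuousOn_u : ContinuousOn (fun p : ℝ × ℝ => derivUnit (T p.1) p.2) (Ioi 0 ×ˢ Icc 0 1)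
  differentiable_flux : ∀ z, 0 < z → ∀ u ∈ Ioo (0 : ℝ) 1,
    DifferentiableAt ℝ (fun v => A v * derivUnit (T z) v) u
  differentiable_z : ∀ z, 0 < z → ∀ u ∈ Ioo (0 : ℝ) 1, DifferentiableAt ℝ (fun s => T s u) z
  continuousOn_z : ContinuousOn (fun p : ℝ × ℝ => deriv (fun s => T s p.2) p.1)
    (Ioi 0 ×ˢ Ioo 0 1)
  equation : ∀ z, 0 < z → ∀ u ∈ Ioo (0 : ℝ) 1,
    deriv (fun s => T s u) z = deriv (fun v => A v * derivUnit (T z) v) u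
  neumann : ∀ z, 0 < z → derivUnit (T z) 0 = 0
  dirichlet : ∀ z, 0 < z → T z 1 = 0
  initial : T 0 =ᵐ[unitVolume] φ
  initial_limit : Tendsto (fun z => eLpNorm (fun u => T z u - φ u) 2 unitVolume) (𝓝[>] 0) (𝓝 0)

/-- The functions in `C^∞([0, 1])` with unit norm in `L²(0, 1)`, vanishing derivative at `0` and
vanishing value at `1`. -/
def admissibleFunctions : Set (ℝ → ℝ) :=
  {ψ | ContDiffOn ℝ ∞ ψ (Icc 0 1) ∧ ∫ v in (0 : ℝ)..1, ψ v ^ 2 = 1 ∧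
    derivUnit ψ 0 = 0 ∧ ψ 1 = 0}

/-- The infimum of `∫₀¹ A(v) ψ'(v)² dv` over the admissible functions `ψ`. -/
def decayRate (A : ℝ → ℝ) : ℝ :=
  sInf ((fun ψ : ℝ → ℝ => ∫ v in (0 : ℝ)..1, A v * derivUnit ψ v ^ 2) '' admissibleFunctions)

end

/-! Put `ρ = 1 / A`, with `A` the diffusion coefficient. Integrating twice inverts the
Sturm-Liouville operator `-(A ψ')'` with its boundary conditions: the inverse is the bounded
operator `G = greenOp ρ` on `L²(0, 1)`, and the form `⟪f, G f⟫ = ∫ ρ |∫₀ᵛ f|²`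
(`inner_greenOp_self`) shows it nonnegative and injective. It is also compact. Working with `G`
avoids unbounded operators: `exp (-z G⁻¹)` and all `G⁻ᵐ exp (-z G⁻¹)` are continuous functions of
`G`, because `x⁻ᵐ exp (-z / x)` extends continuously by `0` to `x ≤ 0`.

The top of the spectrum `μ = ‖G‖` is an eigenvalue. Replacing a function by its modulus does not
decrease the form, so `μ` has an eigenvector positive on `[0, 1)` and is simple
(`exists_groundState`). Integration by parts and a weighted arithmetic-geometric inequality give
`Λ_∞ = 1 / μ`, attained at that eigenvector (`decayRate_eq`).

The semigroup yields a classical solution. Any other solution agrees with it: the difference `w` of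
the two curves satisfies `(G w)' = -w` and tends to `0` at time zero, and an energy argument forces
`w = 0` (`eq_zero_of_hasDerivAt_neg`, `IsDiffusionSolution.eq_heat`). As `z → ∞`, `exp (z / μ) G⁻¹
exp (-z G⁻¹)` converges strongly to `μ⁻¹` times the projection onto the first eigenvector;
evaluating `G` of this at a point, a bounded functional, gives `exp (z / μ) T(z, u) → ⟪e, φ⟫ y(u) >
0`, where `y` is the continuous representative of `e`. Taking logarithms finishes the proof. -/

/-! ### Scalar estimates for the symbols of the semigroup. -/

/-- The function `x ↦ x⁻ᵐ exp (-z / x)`, extended by `0` to `x ≤ 0`. -/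
noncomputable def heatSymbol (m : ℕ) (z x : ℝ) : ℝ := x⁻¹ ^ m * expNegInvGlue (x / z)

theorem heatSymbol_of_pos (m : ℕ) {z x : ℝ} (hz : 0 < z) (hx : 0 < x) :
    heatSymbol m z x = x⁻¹ ^ m * Real.exp (-z * x⁻¹) := by
  have : ¬ x / z ≤ 0 := not_le.2 (by positivity)
  simp only [heatSymbol, expNegInvGlue, this, if_false]
  congr 2
  field_simp

theorem heatSymbol_of_nonpos (m : ℕ) {z x : ℝ} (hz : 0 < z) (hx : x ≤ 0) :
    heatSymbol m z x = 0 := by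
  simp [heatSymbol, expNegInvGlue.zero_of_nonpos (div_nonpos_of_nonpos_of_nonneg hx hz.le)]

/-- The exponential beats every power at `0`. This continuity lets the functional calculus act even
though `0` may lie in the spectrum. -/
theorem continuous_heatSymbol (m : ℕ) {z : ℝ} (hz : 0 < z) : Continuous (heatSymbol m z) := by
  have h := (expNegInvGlue.continuous_polynomial_eval_inv_mul (Polynomial.X ^ m)).comp
    (continuous_id.div_const z)
  have h2 : heatSymbol m z = fun x => z⁻¹ ^ m * ((fun x => Polynomial.eval x⁻¹ (Polynomial.X ^ m) *
      expNegInvGlue x) ∘ fun x => id x / z) x := by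
    funext x
    simp only [heatSymbol, Function.comp, id, Polynomial.eval_pow, Polynomial.eval_X]
    rw [inv_div, ← mul_assoc, ← mul_pow]
    congr 2
    field_simp
  rw [h2]
  exact continuous_const.mul h

theorem pow_mul_exp_neg_le (n : ℕ) {ζ t : ℝ} (hζ : 0 < ζ) (ht : 0 ≤ t) :
    t ^ n * Real.exp (-ζ * t) ≤ n.factorial / ζ ^ n := by
  have h := Real.pow_div_factorial_le_exp (ζ * t) (by positivity) n
  rw [neg_mul, Real.exp_neg, ← div_eq_mul_inv, div_le_div_iff₀ (Real.exp_pos _) (by positivity)]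
  rw [div_le_iff₀ (by positivity), mul_pow] at h
  linarith

theorem hasDerivAt_pow_mul_exp (m : ℕ) (t z : ℝ) :
    HasDerivAt (fun s => t ^ m * Real.exp (-s * t)) (-(t ^ (m + 1) * Real.exp (-z * t))) z := by
  have := (((hasDerivAt_id z).neg.mul_const t).exp).const_mul (t ^ m)
  refine this.congr_deriv ?_
  rw [neg_mul, pow_succ]
  simp only [Pi.neg_apply, id]
  ring

theorem abs_pow_mul_exp_sub_le (m : ℕ) {t z s : ℝ} (ht : 0 ≤ t) (hz : 0 < z)
    (hs : s ∈ Metric.ball z (z / 2)) :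
    |t ^ m * Real.exp (-s * t) - t ^ m * Real.exp (-z * t)| ≤
      (m + 1).factorial / (z / 2) ^ (m + 1) * |s - z| := by
  have hc : Convex ℝ (Metric.ball z (z / 2)) := convex_ball _ _
  refine hc.norm_image_sub_le_of_norm_hasDerivWithin_le
    (f := fun s => t ^ m * Real.exp (-s * t))
    (fun x _ => (hasDerivAt_pow_mul_exp m t x).hasDerivWithinAt) ?_
    (Metric.mem_ball_self (by positivity)) hs
  intro x hx
  rw [norm_neg, Real.norm_of_nonneg (by positivity)]
  refine le_trans ?_ (pow_mul_exp_neg_le (m + 1) (half_pos hz) ht)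
  have : z / 2 ≤ x := by
    rw [Metric.mem_ball, Real.dist_eq, abs_lt] at hx; linarith
  gcongr

/-- A second-order Taylor bound uniform in `t = 1 / x`, hence uniform over the spectrum. The
constant uses only that every time in the ball is at least `z / 2`. -/
theorem abs_pow_mul_exp_sub_sub_le (m : ℕ) {t z s : ℝ} (ht : 0 ≤ t) (hz : 0 < z)
    (hs : s ∈ Metric.ball z (z / 2)) :
    |t ^ m * Real.exp (-s * t) - t ^ m * Real.exp (-z * t) +
      (s - z) * (t ^ (m + 1) * Real.exp (-z * t))| ≤
      (m + 2).factorial / (z / 2) ^ (m + 2) * |s - z| ^ 2 := by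
  have hs' := hs
  rw [Metric.mem_ball, Real.dist_eq] at hs'
  -- On this ball the derivative is itself `O(|s - z|)`, so the mean value inequality produces the
  -- square.
  have hc : Convex ℝ (Metric.closedBall z |s - z|) := convex_closedBall _ _
  have hd : ∀ x, HasDerivAt (fun s => t ^ m * Real.exp (-s * t) - t ^ m * Real.exp (-z * t) +
      (s - z) * (t ^ (m + 1) * Real.exp (-z * t)))
      (-(t ^ (m + 1) * Real.exp (-x * t)) + 1 * (t ^ (m + 1) * Real.exp (-z * t))) x := fun x =>
    ((hasDerivAt_pow_mul_exp m t x).sub_const _).add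
      (((hasDerivAt_id x).sub_const z).mul_const _)
  have := hc.norm_image_sub_le_of_norm_hasDerivWithin_le
    (C := (m + 2).factorial / (z / 2) ^ (m + 2) * |s - z|)
    (fun x _ => (hd x).hasDerivWithinAt) ?_
    (Metric.mem_closedBall_self (abs_nonneg _)) (y := s) (by simp [Real.dist_eq])
  · simp only [sub_self, zero_mul, add_zero, sub_zero, Real.norm_eq_abs] at this
    exact this.trans (by rw [sq, mul_assoc])
  · intro x hx
    rw [Metric.mem_closedBall, Real.dist_eq] at hx
    have := abs_pow_mul_exp_sub_le (m + 1) ht hz (s := x)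
      (by rw [Metric.mem_ball, Real.dist_eq]; linarith)
    rw [one_mul, neg_add_eq_sub, norm_sub_rev, Real.norm_eq_abs]
    refine this.trans ?_
    gcongr

theorem heatSymbol_nonneg (m : ℕ) {z x : ℝ} (hz : 0 < z) : 0 ≤ heatSymbol m z x := by
  rcases le_or_gt x 0 with hx | hx
  · rw [heatSymbol_of_nonpos m hz hx]
  · rw [heatSymbol_of_pos m hz hx]; positivity

theorem abs_heatSymbol_sub_sub_le (m : ℕ) {z s : ℝ} (x : ℝ) (hz : 0 < z)
    (hs : s ∈ Metric.ball z (z / 2)) :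
    |heatSymbol m s x - heatSymbol m z x + (s - z) * heatSymbol (m + 1) z x| ≤
      (m + 2).factorial / (z / 2) ^ (m + 2) * |s - z| ^ 2 := by
  have hs0 : 0 < s := by rw [Metric.mem_ball, Real.dist_eq, abs_lt] at hs; linarith
  rcases le_or_gt x 0 with hx | hx
  · simp only [heatSymbol_of_nonpos _ hz hx, heatSymbol_of_nonpos _ hs0 hx]
    simp only [sub_self, mul_zero, add_zero, abs_zero]
    positivity
  · simp only [heatSymbol_of_pos _ hz hx, heatSymbol_of_pos _ hs0 hx]
    exact abs_pow_mul_exp_sub_sub_le m (by positivity) hz hs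

/-! ### The semigroup of a nonnegative bounded operator through its inverse. -/

section Abstract

variable {H : Type*} [NormedAddCommGroup H] [InnerProductSpace ℂ H] [CompleteSpace H]

/-- `G⁻ᵐ exp (-z G⁻¹)` for a nonnegative operator `G`, by the functional calculus. -/
noncomputable def heatOp (G : H →L[ℂ] H) (m : ℕ) (z : ℝ) : H →L[ℂ] H := cfc (heatSymbol m z) G

/-- The quadratic remainder of the symbol is uniform in `x`, so the functional calculus turns it
into an operator norm bound. -/
theorem hasDerivAt_heatOp (G : H →L[ℂ] H) (m : ℕ) {z : ℝ} (hz : 0 < z) :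
    HasDerivAt (heatOp G m) (-heatOp G (m + 1) z) z := by
  rw [hasDerivAt_iff_isLittleO]
  set C : ℝ := (m + 2).factorial / (z / 2) ^ (m + 2)
  have hC : 0 ≤ C := by positivity
  have key : ∀ᶠ s in 𝓝 z, ‖heatOp G m s - heatOp G m z - (s - z) • -heatOp G (m + 1) z‖ ≤
      C * ‖(s - z) ^ 2‖ := by
    filter_upwards [Metric.ball_mem_nhds z (half_pos hz)] with s hs
    have hs0 : 0 < s := by rw [Metric.mem_ball, Real.dist_eq, abs_lt] at hs; linarith
    have c1 := (continuous_heatSymbol m hs0).continuousOn (s := spectrum ℝ G)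
    have c2 := (continuous_heatSymbol m hz).continuousOn (s := spectrum ℝ G)
    have c3 := (continuous_heatSymbol (m + 1) hz).continuousOn (s := spectrum ℝ G)
    have : heatOp G m s - heatOp G m z - (s - z) • -heatOp G (m + 1) z =
        cfc (fun x => heatSymbol m s x - heatSymbol m z x + (s - z) * heatSymbol (m + 1) z x) G := by
      rw [cfc_add (a := G) (fun x => heatSymbol m s x - heatSymbol m z x)
        (fun x => (s - z) * heatSymbol (m + 1) z x) (c1.sub c2) (continuousOn_const.mul c3),
        cfc_sub _ _ G c1 c2, cfc_const_mul _ _ G c3]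
      simp only [heatOp, smul_neg, sub_neg_eq_add]
    rw [this]
    refine norm_cfc_le (by positivity) fun x _ => ?_
    rw [Real.norm_eq_abs, Real.norm_eq_abs, abs_pow]
    exact abs_heatSymbol_sub_sub_le m x hz hs
  refine (Asymptotics.IsBigO.of_bound C key).trans_isLittleO ?_
  have h := (Asymptotics.isLittleO_pow_id (𝕜 := ℝ) one_lt_two)
  have ht : Tendsto (fun s => s - z) (𝓝 z) (𝓝 0) := by
    rw [← sub_self z]
    exact (continuous_id.sub continuous_const).tendsto z
  exact h.comp_tendsto ht

theorem spectrum_subset_Icc (G : H →L[ℂ] H) (hG : 0 ≤ G) : spectrum ℝ G ⊆ Icc 0 ‖G‖ := by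
  intro x hx
  refine ⟨spectrum_nonneg_of_nonneg hG hx, ?_⟩
  rcases subsingleton_or_nontrivial H with h | h
  · exact absurd hx (by simp [spectrum.of_subsingleton])
  · exact (le_abs_self x).trans (spectrum.norm_le_norm_of_mem hx)

/-- The symbols satisfy `x · x⁻⁽ᵐ⁺¹⁾ = x⁻ᵐ`, also at `x ≤ 0` where both sides vanish. Hence the
orbit at positive time lies in the range of `G`: this is the smoothing effect. -/
theorem mul_heatOp_succ (G : H →L[ℂ] H) (hG : IsSelfAdjoint G) (m : ℕ) {z : ℝ} (hz : 0 < z) :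
    G * heatOp G (m + 1) z = heatOp G m z := by
  have c3 := (continuous_heatSymbol (m + 1) hz).continuousOn (s := spectrum ℝ G)
  conv_lhs => enter [1]; rw [← cfc_id' ℝ G]
  rw [heatOp, ← cfc_mul (fun x => x) _ G continuousOn_id c3]
  refine cfc_congr fun x _ => ?_
  rcases le_or_gt x 0 with hx | hx
  · simp [heatSymbol_of_nonpos _ hz hx]
  · simp only [heatSymbol_of_pos _ hz hx, pow_succ]
    field_simp

theorem norm_heatOp_zero_le (G : H →L[ℂ] H) {z : ℝ} (hz : 0 < z) : ‖heatOp G 0 z‖ ≤ 1 := by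
  refine norm_cfc_le zero_le_one fun x _ => ?_
  rw [Real.norm_of_nonneg (heatSymbol_nonneg _ hz)]
  rcases le_or_gt x 0 with hx | hx
  · simp [heatSymbol_of_nonpos _ hz hx]
  · rw [heatSymbol_of_pos _ hz hx, pow_zero, one_mul, Real.exp_le_one_iff]
    have : 0 < x⁻¹ := by positivity
    nlinarith

/-- From `1 - t ≤ exp (-t)` one gets `x (1 - exp (-z / x)) ≤ z`: continuity at time zero holds in
norm after composition with `G`. -/
theorem norm_heatOp_zero_mul_sub_le (G : H →L[ℂ] H) (hG : 0 ≤ G) {z : ℝ} (hz : 0 < z) :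
    ‖heatOp G 0 z * G - G‖ ≤ z := by
  have hs : IsSelfAdjoint G := IsSelfAdjoint.of_nonneg hG
  have c3 := (continuous_heatSymbol 0 hz).continuousOn (s := spectrum ℝ G)
  have : heatOp G 0 z * G - G = cfc (fun x => heatSymbol 0 z x * x - x) G := by
    rw [cfc_sub (fun x => heatSymbol 0 z x * x) (fun x => x) G (c3.mul continuousOn_id)
      continuousOn_id, cfc_mul _ (fun x => x) G c3 continuousOn_id, cfc_id' ℝ G, heatOp]
  rw [this]
  refine norm_cfc_le hz.le fun x hx => ?_
  have hx0 := (spectrum_subset_Icc G hG hx).1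
  rcases hx0.eq_or_lt with rfl | hx0
  · simpa using hz.le
  · rw [heatSymbol_of_pos _ hz hx0, pow_zero, one_mul, Real.norm_eq_abs, abs_sub_comm, abs_le]
    have h1 : Real.exp (-z * x⁻¹) ≤ 1 := by
      rw [Real.exp_le_one_iff]
      have : 0 < x⁻¹ := by positivity
      nlinarith
    have h2 := Real.add_one_le_exp (-z * x⁻¹)
    have h3 : x * x⁻¹ = 1 := mul_inv_cancel₀ hx0.ne'
    constructor <;> nlinarith

/-- A uniformly bounded family that converges on a range converges on its closure. It serves with `B
= G` as `z → 0` and with `B = G - ‖G‖` as `z → ∞`. -/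
theorem tendsto_apply_zero_of_dense_range {ι : Type*} {l : Filter ι} (S : ι → H →L[ℂ] H)
    (B : H →L[ℂ] H) {C : ℝ} (hS : ∀ᶠ i in l, ‖S i‖ ≤ C)
    (hB : Tendsto (fun i => S i * B) l (𝓝 0)) {x : H} (hx : x ∈ closure (range B)) :
    Tendsto (fun i => S i x) l (𝓝 0) := by
  have hC : 0 < |C| + 1 := by positivity
  rw [Metric.tendsto_nhds]
  intro ε hε
  obtain ⟨_, ⟨g, rfl⟩, hg⟩ := Metric.mem_closure_iff.1 hx (ε / 2 / (|C| + 1)) (by positivity)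
  have h1 : Tendsto (fun i => (S i * B) g) l (𝓝 0) := by
    have := ((ContinuousLinearMap.apply ℂ H g).continuous.tendsto 0).comp hB
    rw [map_zero] at this
    exact this
  filter_upwards [hS, Metric.tendsto_nhds.1 h1 (ε / 2) (by positivity)] with i h2 h3
  rw [dist_zero_right] at h3 ⊢
  have : S i x = S i (x - B g) + (S i * B) g := by simp
  rw [this]
  have h4 : ‖S i (x - B g)‖ ≤ (|C| + 1) * (ε / 2 / (|C| + 1)) := by
    refine ((S i).le_opNorm _).trans ?_
    rw [dist_eq_norm] at hg
    gcongr
    linarith [le_abs_self C]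
  rw [mul_div_cancel₀ _ hC.ne'] at h4
  linarith [norm_add_le (S i (x - B g)) ((S i * B) g)]

/-- For self-adjoint `G` the closure of the range is the orthogonal complement of the kernel, which
is everything by injectivity. -/
theorem tendsto_heatOp_zero (G : H →L[ℂ] H) (hG : 0 ≤ G) (hinj : ∀ x, G x = 0 → x = 0) (x : H) :
    Tendsto (fun z => heatOp G 0 z x) (𝓝[>] 0) (𝓝 x) := by
  have hs : IsSelfAdjoint G := IsSelfAdjoint.of_nonneg hG
  have hd : x ∈ closure (range G) := by
    have h := G.orthogonal_ker
    rw [hs.adjoint_eq] at h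
    have hk : G.ker = ⊥ := by
      rw [LinearMap.ker_eq_bot']
      exact hinj
    rw [hk, Submodule.bot_orthogonal_eq_top] at h
    have : x ∈ (G.range).topologicalClosure := by rw [← h]; trivial
    exact this
  have := tendsto_apply_zero_of_dense_range (fun z => heatOp G 0 z - 1) G (l := 𝓝[>] (0 : ℝ))
    (C := 1 + 1) ?_ ?_ hd
  · simpa using this.add_const x
  · filter_upwards [self_mem_nhdsWithin] with z hz
    refine (norm_sub_le _ _).trans ?_
    exact add_le_add (norm_heatOp_zero_le G hz) ContinuousLinearMap.norm_id_le
  · rw [tendsto_zero_iff_norm_tendsto_zero]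
    refine squeeze_zero' (Eventually.of_forall fun _ => norm_nonneg _)
      (g := fun z => z) ?_ (tendsto_id.mono_left nhdsWithin_le_nhds)
    filter_upwards [self_mem_nhdsWithin] with z hz
    rw [sub_mul, one_mul]
    exact norm_heatOp_zero_mul_sub_le G hG hz


theorem differentiableAt_heatSymbol (m : ℕ) {z x : ℝ} (hz : 0 < z) (hx : 0 < x) :
    DifferentiableAt ℝ (heatSymbol m z) x := by
  have h : heatSymbol m z =ᶠ[𝓝 x] fun x => x⁻¹ ^ m * Real.exp (-z * x⁻¹) := by
    filter_upwards [Ioi_mem_nhds hx] with y hy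
    exact heatSymbol_of_pos m hz hy
  refine DifferentiableAt.congr_of_eventuallyEq ?_ h
  have := hx.ne'
  fun_prop (disch := assumption)

/-- Writing the symbol as `F(x) = q(x) (x - μ) + F(μ)` with `q` the difference quotient, continuous
since `F` is differentiable at `μ > 0`, the first term kills the eigenvector. -/
theorem heatOp_apply_eigenvector (G : H →L[ℂ] H) (hG : IsSelfAdjoint G) (m : ℕ) {z μ : ℝ}
    (hz : 0 < z) (hμ : 0 < μ) {e : H} (he : G e = μ • e) :
    heatOp G m z e = heatSymbol m z μ • e := by
  set F := heatSymbol m z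
  have hF : Continuous F := continuous_heatSymbol m hz
  have hd : Continuous (dslope F μ) := by
    rw [← continuousOn_univ, continuousOn_dslope Filter.univ_mem]
    exact ⟨hF.continuousOn, differentiableAt_heatSymbol m hz hμ⟩
  have h1 : heatOp G m z = cfc (dslope F μ) G * (G - algebraMap ℝ (H →L[ℂ] H) μ) +
      algebraMap ℝ (H →L[ℂ] H) (F μ) := by
    have : heatOp G m z = cfc (fun x => dslope F μ x * (x - μ) + F μ) G := by
      refine cfc_congr fun x _ => ?_
      have := sub_smul_dslope F μ x
      rw [smul_eq_mul] at this
      linear_combination -this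
    rw [this, cfc_add (a := G) (fun x => dslope F μ x * (x - μ)) (fun _ => F μ)
      (hd.continuousOn.mul (continuousOn_id.sub continuousOn_const)) continuousOn_const,
      cfc_mul _ (fun x => x - μ) G hd.continuousOn (continuousOn_id.sub continuousOn_const),
      cfc_sub (fun x => x) (fun _ => μ) G continuousOn_id continuousOn_const, cfc_id' ℝ G,
      cfc_const _ G, cfc_const _ G]
  have h2 : (G - algebraMap ℝ (H →L[ℂ] H) μ) e = 0 := by
    simp [Algebra.algebraMap_eq_smul_one, he]
  rw [h1, add_apply, mul_apply_eq_comp, h2, map_zero, zero_add]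
  simp [Algebra.algebraMap_eq_smul_one]

/-- Since `1 / μ - 1 / x ≤ 0`, the worst time is `z = 1`, where `t exp (-t) ≤ 1` with `t = 1 / x`
leaves only `exp (1 / μ)`. -/
theorem abs_exp_mul_heatSymbol_le {μ x z : ℝ} (hx : x ∈ Icc 0 μ) (hz : 1 ≤ z) :
    |Real.exp (z / μ) * heatSymbol 1 z x| ≤ Real.exp (1 / μ) := by
  have hz0 : 0 < z := by linarith
  rw [abs_of_nonneg (mul_nonneg (Real.exp_pos _).le (heatSymbol_nonneg _ hz0))]
  rcases hx.1.eq_or_lt with rfl | h0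
  · rw [heatSymbol_of_nonpos _ hz0 le_rfl]; simp [Real.exp_nonneg]
  · rw [heatSymbol_of_pos _ hz0 h0, pow_one]
    have h1 : μ⁻¹ ≤ x⁻¹ := inv_anti₀ h0 hx.2
    have h2 := pow_mul_exp_neg_le 1 one_pos (inv_pos.2 h0).le
    simp only [pow_one, Nat.factorial_one, Nat.cast_one, div_one] at h2
    calc Real.exp (z / μ) * (x⁻¹ * Real.exp (-z * x⁻¹))
        = x⁻¹ * Real.exp (z * (μ⁻¹ - x⁻¹)) := by
          rw [mul_left_comm, ← Real.exp_add]; congr 2; ring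
      _ ≤ x⁻¹ * Real.exp (1 * (μ⁻¹ - x⁻¹)) := by
          have : 0 < x⁻¹ := inv_pos.2 h0
          gcongr x⁻¹ * Real.exp ?_
          nlinarith
      _ = Real.exp (1 / μ) * (x⁻¹ * Real.exp (-1 * x⁻¹)) := by
          rw [mul_left_comm, ← Real.exp_add]; congr 2; ring
      _ ≤ Real.exp (1 / μ) * 1 := by gcongr
      _ = _ := mul_one _

/-- With `t = 1 / x - 1 / μ ≥ 0` the left side is `μ t exp (-z t)`, at most `μ / z`. -/
theorem abs_exp_mul_heatSymbol_mul_sub_le {μ x z : ℝ} (hμ : 0 < μ) (hx : x ∈ Icc 0 μ)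
    (hz : 0 < z) : |Real.exp (z / μ) * heatSymbol 1 z x * (x - μ)| ≤ μ / z := by
  rw [abs_mul, abs_of_nonneg (mul_nonneg (Real.exp_pos _).le (heatSymbol_nonneg _ hz))]
  rcases hx.1.eq_or_lt with rfl | h0
  · rw [heatSymbol_of_nonpos _ hz le_rfl]; simp; positivity
  · rw [heatSymbol_of_pos _ hz h0, pow_one, abs_sub_comm, abs_of_nonneg (by linarith [hx.2])]
    have h1 : μ⁻¹ ≤ x⁻¹ := inv_anti₀ h0 hx.2
    have h2 := pow_mul_exp_neg_le 1 hz (sub_nonneg.2 h1)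
    simp only [pow_one, Nat.factorial_one, Nat.cast_one] at h2
    calc Real.exp (z / μ) * (x⁻¹ * Real.exp (-z * x⁻¹)) * (μ - x)
        = μ * ((x⁻¹ - μ⁻¹) * Real.exp (-z * (x⁻¹ - μ⁻¹))) := by
          rw [mul_left_comm, ← Real.exp_add,
            show z / μ + -z * x⁻¹ = -z * (x⁻¹ - μ⁻¹) by ring]
          field_simp
      _ ≤ μ * (1 / z) := by gcongr
      _ = _ := by ring

/-- Such a `y` lies in the closure of the range of `G - ‖G‖`, and composing with `G - ‖G‖` gains a
factor `‖G‖ / z`. No spectral gap is needed. -/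
theorem tendsto_exp_smul_heatOp_zero (G : H →L[ℂ] H) (hG : 0 ≤ G) (hμ : 0 < ‖G‖) {y : H}
    (hy : ∀ k, G k = ‖G‖ • k → inner ℂ k y = 0) :
    Tendsto (fun z => Real.exp (z / ‖G‖) • heatOp G 1 z y) atTop (𝓝 0) := by
  have hs : IsSelfAdjoint G := IsSelfAdjoint.of_nonneg hG
  set μ := ‖G‖
  set B : H →L[ℂ] H := G - algebraMap ℝ (H →L[ℂ] H) μ
  have hB : IsSelfAdjoint B := hs.sub (IsSelfAdjoint.algebraMap _ (IsSelfAdjoint.all μ))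
  have hy' : y ∈ closure (range B) := by
    have h := B.orthogonal_ker
    rw [hB.adjoint_eq] at h
    have : y ∈ (B.range).topologicalClosure := by
      rw [← h, Submodule.mem_orthogonal]
      intro k hk
      refine hy k ?_
      rw [LinearMap.mem_ker] at hk
      have h3 : G k - μ • k = 0 := by
        simpa [B, Algebra.algebraMap_eq_smul_one] using hk
      exact sub_eq_zero.1 h3
    exact this
  refine tendsto_apply_zero_of_dense_range (fun z => Real.exp (z / μ) • heatOp G 1 z) B
    (C := Real.exp (1 / μ)) ?_ ?_ hy'
  · filter_upwards [eventually_ge_atTop 1] with z hz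
    rw [heatOp, ← cfc_const_mul _ _ G
      (continuous_heatSymbol 1 (zero_lt_one.trans_le hz)).continuousOn]
    exact norm_cfc_le (Real.exp_pos _).le fun x hx =>
      abs_exp_mul_heatSymbol_le (spectrum_subset_Icc G hG hx) hz
  · rw [tendsto_zero_iff_norm_tendsto_zero]
    refine squeeze_zero' (Eventually.of_forall fun _ => norm_nonneg _)
      (g := fun z => μ / z) ?_ (tendsto_const_nhds.div_atTop tendsto_id)
    filter_upwards [eventually_gt_atTop 0] with z hz
    have hc := (continuous_heatSymbol 1 hz).continuousOn (s := spectrum ℝ G)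
    have : (Real.exp (z / μ) • heatOp G 1 z) * B =
        cfc (fun x => Real.exp (z / μ) * heatSymbol 1 z x * (x - μ)) G := by
      rw [cfc_mul (fun x => Real.exp (z / μ) * heatSymbol 1 z x) (fun x => x - μ) G
        (continuousOn_const.mul hc) (continuousOn_id.sub continuousOn_const),
        cfc_sub (fun x => x) (fun _ => μ) G continuousOn_id continuousOn_const, cfc_id' ℝ G,
        cfc_const _ G, cfc_const_mul _ _ G hc, heatOp]
    rw [this]
    exact norm_cfc_le (by positivity) fun x hx =>
      abs_exp_mul_heatSymbol_mul_sub_le hμ (spectrum_subset_Icc G hG hx) hz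

theorem tendsto_exp_smul_heatOp (G : H →L[ℂ] H) (hG : 0 ≤ G) (hμ : 0 < ‖G‖) {e y : H} {c : ℂ}
    (he : G e = ‖G‖ • e) (hy : ∀ k, G k = ‖G‖ • k → inner ℂ k y = 0) :
    Tendsto (fun z => Real.exp (z / ‖G‖) • heatOp G 1 z (c • e + y)) atTop
      (𝓝 (‖G‖⁻¹ • c • e)) := by
  have hs : IsSelfAdjoint G := IsSelfAdjoint.of_nonneg hG
  have h1 := (tendsto_exp_smul_heatOp_zero G hG hμ hy).const_add (‖G‖⁻¹ • c • e)
  rw [add_zero] at h1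
  refine h1.congr' ?_
  filter_upwards [eventually_gt_atTop 0] with z hz
  rw [map_add, map_smul, heatOp_apply_eigenvector G hs 1 hz hμ he, smul_add,
    heatSymbol_of_pos 1 hz hμ, smul_comm c, smul_smul, pow_one, mul_left_comm, ← Real.exp_add,
    show z / ‖G‖ + -z * ‖G‖⁻¹ = 0 by ring, Real.exp_zero, mul_one]

/-- Only `G w` is known to be differentiable, so the energy is built from it: `E = ⟪G G w, G w⟫` is
nonnegative, has derivative `-2 ‖G w‖²`, and tends to `0` at time zero, so it vanishes identically.
-/
theorem eq_zero_of_hasDerivAt_neg (G : H →L[ℂ] H) (hG : 0 ≤ G) (hinj : ∀ x, G x = 0 → x = 0)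
    {w : ℝ → H} (hw : ∀ z, 0 < z → HasDerivAt (fun s => G (w s)) (-w z) z)
    (h0 : Tendsto w (𝓝[>] 0) (𝓝 0)) {z : ℝ} (hz : 0 < z) : w z = 0 := by
  have hp : G.IsPositive := (ContinuousLinearMap.nonneg_iff_isPositive G).1 hG
  set E : ℝ → ℝ := fun s => (inner ℂ (G (G (w s))) (G (w s))).re
  have hE : ∀ s, 0 < s → HasDerivAt E (-2 * ‖G (w s)‖ ^ 2) s := by
    intro s hs
    have h1 := hw s hs
    have h2 : HasDerivAt (fun s => G (G (w s))) (G (-w s)) s :=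
      (G.restrictScalars ℝ).hasFDerivAt.comp_hasDerivAt s h1
    have h3 := (Complex.reCLM.hasFDerivAt.comp_hasDerivAt s (h2.inner ℂ h1))
    refine h3.congr_deriv ?_
    have h4 : inner ℂ (G (G (w s))) (w s) = inner ℂ (G (w s)) (G (w s)) :=
      hp.isSymmetric _ _
    rw [inner_neg_right, h4, map_neg, inner_neg_left]
    simp only [Complex.reCLM_apply, Complex.add_re, Complex.neg_re]
    have h5 : (inner ℂ (G (w s)) (G (w s))).re = ‖G (w s)‖ ^ 2 :=
      inner_self_eq_norm_sq (𝕜 := ℂ) _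
    rw [h5]
    ring
  have hE0 : ∀ s, 0 ≤ E s := fun s => hp.re_inner_nonneg_left _
  have hanti : AntitoneOn E (Ioi 0) := by
    refine antitoneOn_of_deriv_nonpos (convex_Ioi 0)
      (fun s hs => (hE s hs).continuousAt.continuousWithinAt) ?_ ?_
    · intro s hs
      rw [interior_Ioi] at hs
      exact (hE s hs).differentiableAt.differentiableWithinAt
    · intro s hs
      rw [interior_Ioi] at hs
      rw [(hE s hs).deriv]
      nlinarith [sq_nonneg ‖G (w s)‖]
  have hlim : Tendsto E (𝓝[>] 0) (𝓝 0) := by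
    have h1 : Tendsto (fun s => G (w s)) (𝓝[>] 0) (𝓝 0) := by
      simpa only [map_zero, Function.comp_def] using (G.continuous.tendsto 0).comp h0
    have h2 : Tendsto (fun s => G (G (w s))) (𝓝[>] 0) (𝓝 0) := by
      simpa only [map_zero, Function.comp_def] using (G.continuous.tendsto 0).comp h1
    have h3 := (Complex.continuous_re.tendsto _).comp (h2.inner (𝕜 := ℂ) h1)
    simpa [Function.comp_def, E] using h3
  have hzero : ∀ s, 0 < s → E s = 0 := by
    intro s hs
    refine le_antisymm (ge_of_tendsto hlim ?_) (hE0 s)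
    filter_upwards [Ioo_mem_nhdsGT hs] with r hr
    exact hanti hr.1 hs hr.2.le
  -- `E` vanishes near `z`, so its derivative `-2 ‖G (w z)‖²` is `0` as well.
  have h5 : HasDerivAt E 0 z := by
    refine (hasDerivAt_const z (0 : ℝ)).congr_of_eventuallyEq ?_
    filter_upwards [Ioi_mem_nhds hz] with s hs
    exact hzero s hs
  have h6 := (hE z hz).unique h5
  refine hinj _ (norm_eq_zero.1 ?_)
  nlinarith [sq_nonneg ‖G (w z)‖]

end Abstract

/-! ### The Green operator on `L²(0, 1)`: positivity, injectivity, compactness. -/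

noncomputable section

/-- The Hilbert space `L²((0, 1); ℂ)`. -/
abbrev UnitL2 : Type := Lp ℂ 2 unitVolume

instance isProbabilityMeasure_unitVolume : IsProbabilityMeasure unitVolume :=
  ⟨by simp [unitVolume]⟩

theorem unitVolume_eq_Ioc : unitVolume = volume.restrict (Ioc 0 1) :=
  Measure.restrict_congr_set Ioo_ae_eq_Ioc

theorem integral_unitVolume {E : Type*} [NormedAddCommGroup E] [NormedSpace ℝ E] (f : ℝ → E) :
    ∫ x, f x ∂unitVolume = ∫ x in (0 : ℝ)..1, f x := by
  rw [intervalIntegral.integral_of_le zero_le_one, unitVolume_eq_Ioc]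

theorem intervalIntegrable_of_unitVolume {E : Type*} [NormedAddCommGroup E] {f : ℝ → E}
    (hf : Integrable f unitVolume) {a b : ℝ} (ha : a ∈ Icc (0 : ℝ) 1) (hb : b ∈ Icc (0 : ℝ) 1) :
    IntervalIntegrable f volume a b := by
  have : IntervalIntegrable f volume 0 1 := by
    rw [intervalIntegrable_iff_integrableOn_Ioc_of_le zero_le_one, IntegrableOn,
      ← unitVolume_eq_Ioc]
    exact hf
  refine this.mono_set ?_
  rw [uIcc_of_le (zero_le_one (α := ℝ))]
  exact uIcc_subset_Icc ha hb

theorem integrable_unitVolume_of_continuousOn {E : Type*} [NormedAddCommGroup E] {f : ℝ → E}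
    (hf : ContinuousOn f (Icc 0 1)) : Integrable f unitVolume :=
  hf.integrableOn_Icc.mono_set Ioo_subset_Icc_self

theorem ae_unitVolume_of_forall {p : ℝ → Prop} (h : ∀ u ∈ Ioo (0 : ℝ) 1, p u) :
    ∀ᵐ u ∂unitVolume, p u :=
  (ae_restrict_mem measurableSet_Ioo).mono h

/-- `v ↦ ∫₀ᵛ f`. -/
def prim (f : ℝ → ℂ) (v : ℝ) : ℂ := ∫ x in (0 : ℝ)..v, f x

/-- `u ↦ ∫ᵤ¹ ρ(v) ∫₀ᵛ f`, the inverse of the Sturm-Liouville operator with coefficient `ρ⁻¹`, Neumann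
condition at `0` and Dirichlet condition at `1`. -/
def green (ρ : C(ℝ, ℝ)) (f : ℝ → ℂ) (u : ℝ) : ℂ := ∫ v in u..1, (ρ v : ℂ) * prim f v

theorem prim_congr_ae {f g : ℝ → ℂ} (h : f =ᵐ[unitVolume] g) {v : ℝ} (hv : v ∈ Icc (0 : ℝ) 1) :
    prim f v = prim g v := by
  rw [prim, prim, intervalIntegral.integral_of_le hv.1, intervalIntegral.integral_of_le hv.1]
  refine integral_congr_ae ?_
  rw [unitVolume_eq_Ioc] at h
  exact ae_mono (Measure.restrict_mono (Ioc_subset_Ioc_right hv.2) le_rfl) h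

theorem green_congr_ae (ρ : C(ℝ, ℝ)) {f g : ℝ → ℂ} (h : f =ᵐ[unitVolume] g) {u : ℝ}
    (hu : u ∈ Icc (0 : ℝ) 1) : green ρ f u = green ρ g u := by
  refine intervalIntegral.integral_congr fun v hv => ?_
  rw [uIcc_of_le hu.2] at hv
  simp only [prim_congr_ae h ⟨hu.1.trans hv.1, hv.2⟩]

theorem prim_add {f g : ℝ → ℂ} (hf : Integrable f unitVolume) (hg : Integrable g unitVolume)
    {v : ℝ} (hv : v ∈ Icc (0 : ℝ) 1) : prim (f + g) v = prim f v + prim g v :=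
  intervalIntegral.integral_add (intervalIntegrable_of_unitVolume hf ⟨le_rfl, zero_le_one⟩ hv)
    (intervalIntegrable_of_unitVolume hg ⟨le_rfl, zero_le_one⟩ hv)

theorem prim_smul (c : ℂ) (f : ℝ → ℂ) (v : ℝ) : prim (c • f) v = c * prim f v :=
  intervalIntegral.integral_smul c f

theorem continuousOn_prim {f : ℝ → ℂ} (hf : Integrable f unitVolume) :
    ContinuousOn (prim f) (Icc 0 1) := by
  have := intervalIntegral.continuousOn_primitive_interval (μ := volume) (f := f) (a := 0)
    (b := 1) ?_
  · rwa [uIcc_of_le zero_le_one] at this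
  · have := intervalIntegrable_of_unitVolume hf (a := 0) (b := 1) (by simp) (by simp)
    rwa [intervalIntegrable_iff'] at this

theorem continuousOn_green_integrand (ρ : C(ℝ, ℝ)) {f : ℝ → ℂ} (hf : Integrable f unitVolume) :
    ContinuousOn (fun v => (ρ v : ℂ) * prim f v) (Icc 0 1) :=
  (Complex.continuous_ofReal.comp ρ.continuous).continuousOn.mul (continuousOn_prim hf)

theorem intervalIntegrable_green_integrand (ρ : C(ℝ, ℝ)) {f : ℝ → ℂ}
    (hf : Integrable f unitVolume) {a b : ℝ} (ha : a ∈ Icc (0 : ℝ) 1) (hb : b ∈ Icc (0 : ℝ) 1) :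
    IntervalIntegrable (fun v => (ρ v : ℂ) * prim f v) volume a b :=
  ((continuousOn_green_integrand ρ hf).mono (uIcc_subset_Icc ha hb)).intervalIntegrable

theorem green_add (ρ : C(ℝ, ℝ)) {f g : ℝ → ℂ} (hf : Integrable f unitVolume)
    (hg : Integrable g unitVolume) {u : ℝ} (hu : u ∈ Icc (0 : ℝ) 1) :
    green ρ (f + g) u = green ρ f u + green ρ g u := by
  have h1 : (1 : ℝ) ∈ Icc (0 : ℝ) 1 := by simp
  rw [green, green, green, ← intervalIntegral.integral_add
    (intervalIntegrable_green_integrand ρ hf hu h1) (intervalIntegrable_green_integrand ρ hg hu h1)]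
  refine intervalIntegral.integral_congr fun v hv => ?_
  rw [uIcc_of_le hu.2] at hv
  simp only [prim_add hf hg ⟨hu.1.trans hv.1, hv.2⟩, mul_add]

theorem green_smul (ρ : C(ℝ, ℝ)) (c : ℂ) (f : ℝ → ℂ) (u : ℝ) :
    green ρ (c • f) u = c * green ρ f u := by
  rw [green, green, ← intervalIntegral.integral_const_mul]
  simp only [prim_smul, mul_left_comm]

theorem norm_prim_le {f : ℝ → ℂ} (hf : Integrable f unitVolume) {v : ℝ}
    (hv : v ∈ Icc (0 : ℝ) 1) : ‖prim f v‖ ≤ ∫ x, ‖f x‖ ∂unitVolume := by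
  refine (intervalIntegral.norm_integral_le_integral_norm hv.1).trans ?_
  rw [intervalIntegral.integral_of_le hv.1, unitVolume_eq_Ioc]
  refine setIntegral_mono_set ?_ (ae_of_all _ fun _ => norm_nonneg _)
    (Ioc_subset_Ioc_right hv.2).eventuallyLE
  have := hf.norm
  rwa [unitVolume_eq_Ioc] at this

theorem integrable_unitL2 (f : UnitL2) : Integrable f unitVolume :=
  (Lp.memLp f).integrable one_le_two

theorem integral_norm_unitL2_le (f : UnitL2) : ∫ x, ‖f x‖ ∂unitVolume ≤ ‖f‖ := by
  rw [integral_norm_eq_lintegral_enorm (Lp.aestronglyMeasurable f), Lp.norm_def,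
    ← eLpNorm_one_eq_lintegral_enorm]
  exact ENNReal.toReal_mono (Lp.eLpNorm_ne_top f)
    (eLpNorm_le_eLpNorm_of_exponent_le one_le_two (Lp.aestronglyMeasurable f))

theorem norm_prim_unitL2_le (f : UnitL2) {v : ℝ} (hv : v ∈ Icc (0 : ℝ) 1) : ‖prim f v‖ ≤ ‖f‖ :=
  (norm_prim_le (integrable_unitL2 f) hv).trans (integral_norm_unitL2_le f)

/-- The supremum of `|ρ|` on `[0, 1]`. -/
def supUnit (ρ : C(ℝ, ℝ)) : ℝ := ‖ρ.restrict (Icc 0 1)‖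

theorem supUnit_nonneg (ρ : C(ℝ, ℝ)) : 0 ≤ supUnit ρ := norm_nonneg _

theorem abs_le_supUnit (ρ : C(ℝ, ℝ)) {v : ℝ} (hv : v ∈ Icc (0 : ℝ) 1) : |ρ v| ≤ supUnit ρ :=
  (ρ.restrict (Icc 0 1)).norm_coe_le_norm ⟨v, hv⟩

theorem green_sub_green (ρ : C(ℝ, ℝ)) {f : ℝ → ℂ} (hf : Integrable f unitVolume) {u v : ℝ}
    (hu : u ∈ Icc (0 : ℝ) 1) (hv : v ∈ Icc (0 : ℝ) 1) :
    green ρ f u - green ρ f v = ∫ x in u..v, (ρ x : ℂ) * prim f x := by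
  rw [green, green, sub_eq_iff_eq_add, intervalIntegral.integral_add_adjacent_intervals]
  · exact intervalIntegrable_green_integrand ρ hf hu hv
  · exact intervalIntegrable_green_integrand ρ hf hv (by simp)

/-- This Lipschitz bound, linear in the `L²` norm of `f`, gives the continuity of `green ρ f`, the
boundedness of the operator (take `v = 1`) and its compactness. -/
theorem norm_green_sub_green_le (ρ : C(ℝ, ℝ)) (f : UnitL2) {u v : ℝ}
    (hu : u ∈ Icc (0 : ℝ) 1) (hv : v ∈ Icc (0 : ℝ) 1) :
    ‖green ρ f u - green ρ f v‖ ≤ supUnit ρ * ‖f‖ * |v - u| := by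
  rw [green_sub_green ρ (integrable_unitL2 f) hu hv]
  refine intervalIntegral.norm_integral_le_of_norm_le_const fun x hx => ?_
  have hx' : x ∈ Icc (0 : ℝ) 1 := uIcc_subset_Icc hu hv (uIoc_subset_uIcc hx)
  rw [norm_mul, Complex.norm_real]
  exact mul_le_mul (abs_le_supUnit ρ hx') (norm_prim_unitL2_le f hx') (norm_nonneg _)
    (supUnit_nonneg ρ)

theorem green_one (ρ : C(ℝ, ℝ)) (f : ℝ → ℂ) : green ρ f 1 = 0 :=
  intervalIntegral.integral_same

theorem norm_green_le (ρ : C(ℝ, ℝ)) (f : UnitL2) {u : ℝ} (hu : u ∈ Icc (0 : ℝ) 1) :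
    ‖green ρ f u‖ ≤ supUnit ρ * ‖f‖ := by
  have h := norm_green_sub_green_le ρ f hu (v := 1) (by simp)
  rw [green_one, sub_zero] at h
  refine h.trans (mul_le_of_le_one_right (mul_nonneg (supUnit_nonneg ρ) (norm_nonneg _)) ?_)
  rw [abs_of_nonneg (by linarith [hu.2])]
  linarith [hu.1]

theorem continuousOn_green (ρ : C(ℝ, ℝ)) (f : UnitL2) : ContinuousOn (green ρ f) (Icc 0 1) := by
  refine LipschitzOnWith.continuousOn (K := (supUnit ρ * ‖f‖).toNNReal) ?_
  refine LipschitzOnWith.of_dist_le_mul fun u hu v hv => ?_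
  rw [Real.coe_toNNReal _ (mul_nonneg (supUnit_nonneg ρ) (norm_nonneg _)), dist_eq_norm,
    Real.dist_eq, abs_sub_comm u v]
  exact norm_green_sub_green_le ρ f hu hv

theorem memLp_of_continuousOn {E : Type*} [NormedAddCommGroup E] {f : ℝ → E}
    (hf : ContinuousOn f (Icc 0 1)) : MemLp f 2 unitVolume := by
  obtain ⟨C, hC⟩ := isCompact_Icc.exists_bound_of_continuousOn hf
  exact MemLp.of_bound (integrable_unitVolume_of_continuousOn hf).aestronglyMeasurable C
    (ae_unitVolume_of_forall fun u hu => hC u (Ioo_subset_Icc_self hu))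

/-- `f ↦ green ρ f` as a bounded operator on `L²(0, 1)`. -/
def greenOp (ρ : C(ℝ, ℝ)) : UnitL2 →L[ℂ] UnitL2 :=
  LinearMap.mkContinuousOfExistsBound
    { toFun := fun f => (memLp_of_continuousOn (continuousOn_green ρ f)).toLp (green ρ f)
      map_add' := fun f g => by
        rw [← MemLp.toLp_add]
        refine MemLp.toLp_congr _ _ (ae_unitVolume_of_forall fun u hu => ?_)
        rw [green_congr_ae ρ (Lp.coeFn_add f g) (Ioo_subset_Icc_self hu)]
        exact green_add ρ (integrable_unitL2 f) (integrable_unitL2 g) (Ioo_subset_Icc_self hu)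
      map_smul' := fun c f => by
        rw [RingHom.id_apply, ← MemLp.toLp_const_smul]
        refine MemLp.toLp_congr _ _ (ae_unitVolume_of_forall fun u hu => ?_)
        rw [green_congr_ae ρ (Lp.coeFn_smul c f) (Ioo_subset_Icc_self hu)]
        exact green_smul ρ c f u }
    ⟨supUnit ρ, fun f => by
      refine (Lp.norm_le_of_ae_bound (C := supUnit ρ * ‖f‖)
        (mul_nonneg (supUnit_nonneg ρ) (norm_nonneg _)) ?_).trans_eq ?_
      · filter_upwards [MemLp.coeFn_toLp (memLp_of_continuousOn (continuousOn_green ρ f)),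
          ae_unitVolume_of_forall (fun u hu => hu)] with u h1 h2
        simp only [LinearMap.coe_mk, AddHom.coe_mk, h1]
        exact norm_green_le ρ f (Ioo_subset_Icc_self h2)
      · simp [measureUnivNNReal]⟩

theorem coeFn_greenOp (ρ : C(ℝ, ℝ)) (f : UnitL2) : greenOp ρ f =ᵐ[unitVolume] green ρ f :=
  MemLp.coeFn_toLp (memLp_of_continuousOn (continuousOn_green ρ f))

/-- The value of `green ρ f` at a point, as a bounded functional of `f`. -/
def greenAt (ρ : C(ℝ, ℝ)) (u : Icc (0 : ℝ) 1) : UnitL2 →L[ℂ] ℂ :=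
  LinearMap.mkContinuousOfExistsBound
    { toFun := fun f => green ρ f u
      map_add' := fun f g => by
        rw [green_congr_ae ρ (Lp.coeFn_add f g) u.2]
        exact green_add ρ (integrable_unitL2 f) (integrable_unitL2 g) u.2
      map_smul' := fun c f => by
        rw [green_congr_ae ρ (Lp.coeFn_smul c f) u.2]
        exact green_smul ρ c f u }
    ⟨supUnit ρ, fun f => norm_green_le ρ f u.2⟩

theorem greenAt_apply (ρ : C(ℝ, ℝ)) (u : Icc (0 : ℝ) 1) (f : UnitL2) :
    greenAt ρ u f = green ρ f u := rfl

/-- Fubini on the triangle `u < v`. It plays the part of integration by parts for merely integrable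
functions. -/
theorem integral_mul_integral_swap {f h : ℝ → ℂ} (hf : Integrable f unitVolume)
    (hh : Integrable h unitVolume) :
    ∫ u, f u * (∫ v in u..1, h v) ∂unitVolume = ∫ v, prim f v * h v ∂unitVolume := by
  set F : ℝ → ℝ → ℂ := fun u v => ({p : ℝ × ℝ | p.1 < p.2}.indicator fun p => f p.1 * h p.2) (u, v)
  have hF : Integrable (Function.uncurry F) (unitVolume.prod unitVolume) :=
    (hf.mul_prod hh).indicator (measurableSet_lt measurable_fst measurable_snd)
  have key := integral_integral_swap hF
  have h1 : ∀ u ∈ Ioo (0 : ℝ) 1, ∫ v, F u v ∂unitVolume = f u * ∫ v in u..1, h v := by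
    intro u hu
    have : F u = (Ioi u).indicator fun v => f u * h v := by
      funext v; simp only [F, indicator, mem_ofPred_eq, mem_Ioi]
    rw [this, integral_indicator measurableSet_Ioi, unitVolume,
      Measure.restrict_restrict measurableSet_Ioi, integral_const_mul,
      intervalIntegral.integral_of_le hu.2.le, integral_Ioc_eq_integral_Ioo]
    congr 3
    ext v
    simp only [mem_inter_iff, mem_Ioi, mem_Ioo]
    exact ⟨fun h => ⟨h.1, h.2.2⟩, fun h => ⟨h.1, hu.1.trans h.1, h.2⟩⟩
  have h2 : ∀ v ∈ Ioo (0 : ℝ) 1, ∫ u, F u v ∂unitVolume = prim f v * h v := by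
    intro v hv
    have : (fun u => F u v) = (Iio v).indicator fun u => f u * h v := by
      funext u; simp only [F, indicator, mem_ofPred_eq, mem_Iio]
    rw [this, integral_indicator measurableSet_Iio, unitVolume,
      Measure.restrict_restrict measurableSet_Iio, integral_mul_const, prim,
      intervalIntegral.integral_of_le hv.1.le, integral_Ioc_eq_integral_Ioo]
    congr 3
    ext u
    simp only [mem_inter_iff, mem_Iio, mem_Ioo]
    exact ⟨fun h => ⟨h.2.1, h.1⟩, fun h => ⟨h.2, h.1, h.2.trans hv.2⟩⟩
  rw [← integral_congr_ae (ae_unitVolume_of_forall h1), key,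
    integral_congr_ae (ae_unitVolume_of_forall h2)]

theorem prim_conj (f : ℝ → ℂ) (v : ℝ) :
    prim (fun u => starRingEnd ℂ (f u)) v = starRingEnd ℂ (prim f v) := by
  simp only [prim, intervalIntegral, integral_conj, map_sub]

/-- This is the factorization `G = P* ρ P` with `P` the Volterra operator `prim`; symmetry,
positivity and the comparison with moduli are read off from it. -/
theorem inner_greenOp (ρ : C(ℝ, ℝ)) (f g : UnitL2) :
    inner ℂ f (greenOp ρ g) =
      ∫ v, starRingEnd ℂ (prim f v) * ((ρ v : ℂ) * prim g v) ∂unitVolume := by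
  rw [L2.inner_def]
  have h : ∀ᵐ u ∂unitVolume, inner ℂ (f u) (greenOp ρ g u) =
      starRingEnd ℂ (f u) * ∫ v in u..1, (ρ v : ℂ) * prim g v := by
    filter_upwards [coeFn_greenOp ρ g] with u hu
    rw [hu, RCLike.inner_apply', green]
  rw [integral_congr_ae h, integral_mul_integral_swap]
  · simp only [prim_conj]
  · exact (RCLike.conjLIE (K := ℂ)).integrable_comp_iff.2 (integrable_unitL2 f)
  · exact integrable_unitVolume_of_continuousOn
      (continuousOn_green_integrand ρ (integrable_unitL2 g))

theorem inner_greenOp_self (ρ : C(ℝ, ℝ)) (f : UnitL2) :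
    inner ℂ f (greenOp ρ f) = ((∫ v, ρ v * ‖prim f v‖ ^ 2 ∂unitVolume : ℝ) : ℂ) := by
  rw [inner_greenOp, ← integral_complex_ofReal]
  refine integral_congr_ae (ae_of_all _ fun v => ?_)
  simp only [Complex.ofReal_mul, Complex.ofReal_pow]
  rw [mul_left_comm, ← Complex.conj_mul']

theorem greenOp_nonneg (ρ : C(ℝ, ℝ)) (hρ : ∀ v ∈ Icc (0 : ℝ) 1, 0 < ρ v) : 0 ≤ greenOp ρ := by
  rw [ContinuousLinearMap.nonneg_iff_isPositive, ContinuousLinearMap.isPositive_def]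
  constructor
  · intro f g
    rw [← inner_conj_symm]
    simp only [ContinuousLinearMap.coe_coe]
    rw [inner_greenOp, inner_greenOp, ← integral_conj]
    refine integral_congr_ae (ae_of_all _ fun v => ?_)
    simp only [map_mul, Complex.conj_ofReal, Complex.conj_conj]
    ring
  · intro f
    rw [ContinuousLinearMap.reApplyInnerSelf, ← inner_conj_symm, inner_greenOp_self,
      Complex.conj_ofReal]
    refine integral_nonneg_of_ae (ae_unitVolume_of_forall fun v hv => ?_)
    exact mul_nonneg (hρ v (Ioo_subset_Icc_self hv)).le (sq_nonneg _)

theorem ae_eq_zero_of_prim_eq_zero {f : ℝ → ℂ} (hf : Integrable f unitVolume)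
    (h : ∀ v ∈ Ioo (0 : ℝ) 1, prim f v = 0) : f =ᵐ[unitVolume] 0 := by
  have h1 := (intervalIntegrable_of_unitVolume hf (a := 0) (b := 1) (by simp)
    (by simp)).ae_hasDerivAt_integral
  rw [Filter.EventuallyEq, unitVolume, ae_restrict_iff' measurableSet_Ioo]
  filter_upwards [h1] with x hx hx01
  have h2 := hx (by rw [uIcc_of_le zero_le_one]; exact Ioo_subset_Icc_self hx01) 0 (by simp)
  refine h2.unique ((hasDerivAt_const x (0 : ℂ)).congr_of_eventuallyEq ?_)
  filter_upwards [Ioo_mem_nhds hx01.1 hx01.2] with y hy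
  exact h y hy

theorem eqOn_zero_of_integral_eq_zero {g : ℝ → ℝ} (hg : ContinuousOn g (Icc 0 1))
    (h0 : ∀ v ∈ Ioo (0 : ℝ) 1, 0 ≤ g v) (hi : ∫ v, g v ∂unitVolume = 0) :
    ∀ v ∈ Ioo (0 : ℝ) 1, g v = 0 := by
  have h1 := (integral_eq_zero_iff_of_nonneg_ae (ae_unitVolume_of_forall h0)
    (integrable_unitVolume_of_continuousOn hg)).1 hi
  exact Measure.eqOn_open_of_ae_eq h1 isOpen_Ioo (hg.mono Ioo_subset_Icc_self)
    continuousOn_const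

/-- If `G f = 0`, the form vanishes at `f`; its integrand is continuous and nonnegative, so `prim f
= 0`, and Lebesgue differentiation gives `f = 0`. -/
theorem greenOp_injective (ρ : C(ℝ, ℝ)) (hρ : ∀ v ∈ Icc (0 : ℝ) 1, 0 < ρ v) (f : UnitL2)
    (hf : greenOp ρ f = 0) : f = 0 := by
  have h1 := inner_greenOp_self ρ f
  rw [hf, inner_zero_right, eq_comm, Complex.ofReal_eq_zero] at h1
  have h2 := eqOn_zero_of_integral_eq_zero ?_ ?_ h1
  · refine Lp.ext ((ae_eq_zero_of_prim_eq_zero (integrable_unitL2 f) fun v hv => ?_).trans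
      (Lp.coeFn_zero ℂ 2 unitVolume).symm)
    have h3 := h2 v hv
    rw [mul_eq_zero, or_iff_right (hρ v (Ioo_subset_Icc_self hv)).ne'] at h3
    simpa using h3
  · exact ρ.continuous.continuousOn.mul ((continuousOn_prim (integrable_unitL2 f)).norm.pow 2)
  · exact fun v hv => mul_nonneg (hρ v (Ioo_subset_Icc_self hv)).le (sq_nonneg _)

/-- `Fin.ofNat` reduces modulo `n + 1`, which makes the function total; for `u` in `(0, 1)` the
index is below `n + 1` and nothing wraps around. -/
theorem memLp_step (n : ℕ) (c : Fin (n + 1) → ℂ) :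
    MemLp (fun u : ℝ => c (Fin.ofNat (n + 1) ⌊n * u⌋₊)) 2 unitVolume := by
  refine MemLp.of_bound (Measurable.aestronglyMeasurable ?_) ‖c‖
    (ae_of_all _ fun u => norm_le_pi_norm c _)
  exact (measurable_of_countable fun k : ℕ => c (Fin.ofNat (n + 1) k)).comp
    (Nat.measurable_floor.comp (measurable_const_mul _))

/-- The step function taking the value `c k` on `[k / n, (k + 1) / n)`. -/
def stepFun (n : ℕ) : (Fin (n + 1) → ℂ) →ₗ[ℂ] UnitL2 where
  toFun c := (memLp_step n c).toLp
  map_add' c c' := by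
    rw [← MemLp.toLp_add]
    rfl
  map_smul' a c := by
    rw [RingHom.id_apply, ← MemLp.toLp_const_smul]
    rfl

theorem coeFn_stepFun (n : ℕ) (c : Fin (n + 1) → ℂ) :
    stepFun n c =ᵐ[unitVolume] fun u : ℝ => c (Fin.ofNat (n + 1) ⌊n * u⌋₊) :=
  (memLp_step n c).coeFn_toLp

theorem div_mem_unit {n : ℕ} (k : Fin (n + 1)) : ((k : ℕ) / n : ℝ) ∈ Icc (0 : ℝ) 1 := by
  refine ⟨by positivity, div_le_one_of_le₀ ?_ (by positivity)⟩
  exact_mod_cast Nat.lt_succ_iff.1 k.2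

/-- The approximation of `greenOp ρ` by sampling at the points `k / n`. -/
def greenStep (ρ : C(ℝ, ℝ)) (n : ℕ) : UnitL2 →L[ℂ] UnitL2 :=
  (stepFun n).toContinuousLinearMap ∘L
    ContinuousLinearMap.pi fun k : Fin (n + 1) => greenAt ρ ⟨(k : ℕ) / n, div_mem_unit k⟩

theorem norm_greenOp_sub_greenStep_le (ρ : C(ℝ, ℝ)) {n : ℕ} (hn : 0 < n) :
    ‖greenOp ρ - greenStep ρ n‖ ≤ supUnit ρ * (1 / n) := by
  have hn' : (0 : ℝ) < n := by exact_mod_cast hn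
  have hs := supUnit_nonneg ρ
  refine ContinuousLinearMap.opNorm_le_bound _ (by positivity) fun f => ?_
  refine (Lp.norm_le_of_ae_bound (C := supUnit ρ * (1 / n) * ‖f‖) (by positivity) ?_).trans_eq ?_
  · have h3 := coeFn_stepFun n fun k : Fin (n + 1) => green ρ f ((k : ℕ) / n)
    filter_upwards [coeFn_greenOp ρ f, h3, Lp.coeFn_sub (greenOp ρ f) (greenStep ρ n f),
      ae_unitVolume_of_forall (fun u hu => hu)] with u h1 h2 h4 hu
    have h5 : ((greenOp ρ - greenStep ρ n) f : UnitL2) u =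
        green ρ f u - green ρ f ((Fin.ofNat (n + 1) ⌊n * u⌋₊ : ℕ) / n) := by
      rw [sub_apply, h4, Pi.sub_apply, h1]
      congr 1
    rw [h5]
    refine (norm_green_sub_green_le ρ f (Ioo_subset_Icc_self hu) (div_mem_unit _)).trans ?_
    rw [mul_right_comm]
    gcongr
    have h6 : ⌊n * u⌋₊ < n + 1 := by
      rw [Nat.floor_lt (by have := hu.1; positivity)]
      push_cast
      nlinarith [hu.2]
    have h7 : ((Fin.ofNat (n + 1) ⌊n * u⌋₊ : Fin (n + 1)) : ℕ) = ⌊n * u⌋₊ := by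
      simp [Fin.ofNat, Nat.mod_eq_of_lt h6]
    rw [h7, abs_sub_comm]
    have h8 := Nat.floor_le (show 0 ≤ n * u by have := hu.1; positivity)
    have h9 := Nat.lt_floor_add_one (n * u)
    rw [show u - (⌊n * u⌋₊ : ℝ) / n = (n * u - ⌊n * u⌋₊) / n by field_simp, abs_div,
      abs_of_pos hn', abs_of_nonneg (by linarith)]
    gcongr
    linarith
  · simp [measureUnivNNReal]

/-- The sampled operators have finite rank, and by the Lipschitz bound they converge in norm at rate
`1 / n`. -/
theorem isCompactOperator_greenOp (ρ : C(ℝ, ℝ)) : IsCompactOperator (greenOp ρ) := by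
  refine isCompactOperator_of_tendsto (l := atTop) (F := fun n : ℕ => greenStep ρ n) ?_
    (Eventually.of_forall fun n => ?_)
  · rw [tendsto_iff_norm_sub_tendsto_zero]
    refine squeeze_zero' (Eventually.of_forall fun _ => norm_nonneg _)
      (g := fun n : ℕ => supUnit ρ * (1 / (n : ℝ))) ?_ ?_
    · filter_upwards [eventually_gt_atTop 0] with n hn
      rw [norm_sub_rev]
      exact norm_greenOp_sub_greenStep_le ρ hn
    · simpa using tendsto_one_div_atTop_nhds_zero_nat.const_mul (supUnit ρ)
  · exact (isCompactOperator_of_locallyCompactSpace_rng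
      (stepFun n).toContinuousLinearMap).comp_clm _

end

/-! ### The first eigenvector: existence, positivity, simplicity. -/

noncomputable section

theorem hasDerivWithinAt_integral_right {E : Type*} [NormedAddCommGroup E] [NormedSpace ℝ E]
    [CompleteSpace E] {f : ℝ → E} (hf : ContinuousOn f (Icc 0 1)) {v : ℝ}
    (hv : v ∈ Icc (0 : ℝ) 1) :
    HasDerivWithinAt (fun v => ∫ x in (0 : ℝ)..v, f x) (f v) (Icc 0 1) v := by
  have : Fact (v ∈ Icc (0 : ℝ) 1) := ⟨hv⟩
  exact intervalIntegral.integral_hasDerivWithinAt_right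
    ((hf.mono (uIcc_subset_Icc (by simp) hv)).intervalIntegrable)
    (hf.stronglyMeasurableAtFilter_nhdsWithin measurableSet_Icc v) (hf v hv)

theorem hasDerivWithinAt_integral_left {E : Type*} [NormedAddCommGroup E] [NormedSpace ℝ E]
    [CompleteSpace E] {f : ℝ → E} (hf : ContinuousOn f (Icc 0 1)) {v : ℝ}
    (hv : v ∈ Icc (0 : ℝ) 1) :
    HasDerivWithinAt (fun v => ∫ x in v..1, f x) (-f v) (Icc 0 1) v := by
  have : Fact (v ∈ Icc (0 : ℝ) 1) := ⟨hv⟩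
  exact intervalIntegral.integral_hasDerivWithinAt_left
    ((hf.mono (uIcc_subset_Icc hv (by simp))).intervalIntegrable)
    (hf.stronglyMeasurableAtFilter_nhdsWithin measurableSet_Icc v) (hf v hv)

theorem derivUnit_eq {f : ℝ → ℝ} {f' u : ℝ} (h : HasDerivWithinAt f f' (Icc 0 1) u)
    (hu : u ∈ Icc (0 : ℝ) 1) : derivUnit f u = f' :=
  h.derivWithin (uniqueDiffOn_Icc_zero_one u hu)

theorem eqOn_Icc_of_ae_unitVolume {E : Type*} [TopologicalSpace E] [T2Space E] {f g : ℝ → E}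
    (h : f =ᵐ[unitVolume] g) (hf : ContinuousOn f (Icc 0 1)) (hg : ContinuousOn g (Icc 0 1)) :
    EqOn f g (Icc 0 1) := by
  refine Measure.eqOn_Icc_of_ae_eq volume zero_ne_one ?_ hf hg
  rwa [← Measure.restrict_congr_set Ioo_ae_eq_Icc]

/-- The equality case of Cauchy-Schwarz: expanding `‖G g - ‖G‖ g‖²` gives at most `0`. -/
theorem apply_eq_of_inner_eq {H : Type*} [NormedAddCommGroup H] [InnerProductSpace ℂ H]
    (G : H →L[ℂ] H) {g : H} (h : (inner ℂ g (G g)).re = ‖G‖ * ‖g‖ ^ 2) : G g = ‖G‖ • g := by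
  rw [← sub_eq_zero, ← norm_eq_zero, ← sq_eq_zero_iff]
  refine le_antisymm ?_ (sq_nonneg _)
  have h1 := norm_sub_sq (𝕜 := ℂ) (G g) (‖G‖ • g)
  have h2 : RCLike.re (inner ℂ (G g) (‖G‖ • g)) = ‖G‖ * (‖G‖ * ‖g‖ ^ 2) := by
    rw [← h, ← Complex.coe_smul, inner_smul_right, ← inner_conj_symm]
    simp only [RCLike.re_eq_complex_re, Complex.re_ofReal_mul, Complex.conj_re]
  rw [h1, h2, norm_smul, norm_norm]
  have h3 := G.le_opNorm g
  have h4 : ‖G g‖ ^ 2 ≤ (‖G‖ * ‖g‖) ^ 2 := by gcongr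
  nlinarith

theorem ofReal_smul_unitL2 (r : ℝ) (f : UnitL2) : (r : ℂ) • f = r • f :=
  Complex.coe_smul r f

theorem exists_ne_zero_unitL2 : ∃ f : UnitL2, f ≠ 0 := by
  refine ⟨Lp.const 2 unitVolume 1, fun h => ?_⟩
  have := Lp.norm_const' (μ := unitVolume) (p := 2) (c := (1 : ℂ)) two_ne_zero (by simp)
  simp [h] at this

instance nontrivial_unitL2 : Nontrivial UnitL2 :=
  let ⟨f, hf⟩ := exists_ne_zero_unitL2
  ⟨⟨f, 0, hf⟩⟩

theorem memLp_norm (f : UnitL2) : MemLp (fun u => ((‖f u‖ : ℝ) : ℂ)) 2 unitVolume :=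
  (Lp.memLp f).norm.ofReal

/-- The modulus of an element of `L²(0, 1)`. -/
def absL2 (f : UnitL2) : UnitL2 := (memLp_norm f).toLp

theorem coeFn_absL2 (f : UnitL2) : absL2 f =ᵐ[unitVolume] fun u => ((‖f u‖ : ℝ) : ℂ) :=
  (memLp_norm f).coeFn_toLp

theorem norm_absL2 (f : UnitL2) : ‖absL2 f‖ = ‖f‖ := by
  rw [Lp.norm_def, Lp.norm_def]
  congr 1
  refine eLpNorm_congr_norm_ae ?_
  filter_upwards [coeFn_absL2 f] with u hu
  simp [hu]

theorem prim_absL2 (f : UnitL2) {v : ℝ} (hv : v ∈ Icc (0 : ℝ) 1) :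
    prim (absL2 f) v = ((∫ x in (0 : ℝ)..v, ‖f x‖ : ℝ) : ℂ) := by
  rw [prim_congr_ae (coeFn_absL2 f) hv, prim, intervalIntegral.integral_ofReal]

theorem norm_prim_le_prim_absL2 (f : UnitL2) {v : ℝ} (hv : v ∈ Icc (0 : ℝ) 1) :
    ‖prim f v‖ ≤ ‖prim (absL2 f) v‖ := by
  rw [prim_absL2 f hv, Complex.norm_real]
  exact (intervalIntegral.norm_integral_le_integral_norm hv.1).trans (le_abs_self _)

theorem integrable_weighted_prim_sq (ρ : C(ℝ, ℝ)) (f : UnitL2) :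
    Integrable (fun v => ρ v * ‖prim f v‖ ^ 2) unitVolume :=
  integrable_unitVolume_of_continuousOn
    (ρ.continuous.continuousOn.mul ((continuousOn_prim (integrable_unitL2 f)).norm.pow 2))

variable (ρ : C(ℝ, ℝ))

/-- Since `|∫₀ᵛ f| ≤ ∫₀ᵛ |f|`, the modulus has the same norm and no smaller form, so it also attains
the maximum `‖G‖` of the quadratic form. -/
theorem greenOp_absL2_of_eigenvector (hρ : ∀ v ∈ Icc (0 : ℝ) 1, 0 < ρ v) {f : UnitL2}
    (hf : greenOp ρ f = ‖greenOp ρ‖ • f) :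
    greenOp ρ (absL2 f) = ‖greenOp ρ‖ • absL2 f := by
  refine apply_eq_of_inner_eq _ (le_antisymm ?_ ?_)
  · refine (Complex.re_le_norm _).trans ((norm_inner_le_norm _ _).trans ?_)
    have := (greenOp ρ).le_opNorm (absL2 f)
    nlinarith [norm_nonneg (absL2 f)]
  · have h1 : (inner ℂ f (greenOp ρ f)).re = ‖greenOp ρ‖ * ‖f‖ ^ 2 := by
      rw [hf, ← ofReal_smul_unitL2, inner_smul_right, Complex.re_ofReal_mul]
      congr 1
      exact inner_self_eq_norm_sq (𝕜 := ℂ) f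
    rw [norm_absL2, ← h1, inner_greenOp_self, inner_greenOp_self, Complex.ofReal_re,
      Complex.ofReal_re]
    refine integral_mono_ae (integrable_weighted_prim_sq ρ f)
      (integrable_weighted_prim_sq ρ (absL2 f)) (ae_unitVolume_of_forall fun v hv => ?_)
    have hv' := Ioo_subset_Icc_self hv
    have := norm_prim_le_prim_absL2 f hv'
    have := (hρ v hv').le
    dsimp only
    gcongr

theorem green_absL2 (f : UnitL2) {u : ℝ} (hu : u ∈ Icc (0 : ℝ) 1) :
    green ρ (absL2 f) u = ((∫ v in u..1, ρ v * ∫ x in (0 : ℝ)..v, ‖f x‖ : ℝ) : ℂ) := by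
  rw [green, ← intervalIntegral.integral_ofReal]
  refine intervalIntegral.integral_congr fun v hv => ?_
  rw [uIcc_of_le hu.2] at hv
  simp only [prim_absL2 f ⟨hu.1.trans hv.1, hv.2⟩, Complex.ofReal_mul]

theorem integral_green_abs_pos (hρ : ∀ v ∈ Icc (0 : ℝ) 1, 0 < ρ v) {f : UnitL2}
    (hf : f ≠ 0) {u : ℝ} (hu : u ∈ Ico (0 : ℝ) 1) :
    0 < ∫ v in u..1, ρ v * ∫ x in (0 : ℝ)..v, ‖f x‖ := by
  have hi := (integrable_unitL2 f).norm
  have hc : ContinuousOn (fun v => ∫ x in (0 : ℝ)..v, ‖f x‖) (Icc 0 1) := by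
    have := intervalIntegral.continuousOn_primitive_interval (μ := volume) (f := fun x => ‖f x‖)
      (a := 0) (b := 1) ?_
    · rwa [uIcc_of_le zero_le_one] at this
    · have := intervalIntegrable_of_unitVolume hi (a := 0) (b := 1) (by simp) (by simp)
      rwa [intervalIntegrable_iff'] at this
  have hnn : ∀ v, 0 ≤ v → 0 ≤ ∫ x in (0 : ℝ)..v, ‖f x‖ := fun v hv =>
    intervalIntegral.integral_nonneg hv fun _ _ => norm_nonneg _
  refine intervalIntegral.integral_pos hu.2
    ((ρ.continuous.continuousOn.mul hc).mono (Icc_subset_Icc_left hu.1)) (fun v hv => ?_)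
    -- At `v = 1` the inner integral is the full `L¹` norm of `f`, which is positive.
    ⟨1, ⟨hu.2.le, le_rfl⟩, ?_⟩
  · exact mul_nonneg (hρ v ⟨hu.1.trans hv.1.le, hv.2⟩).le (hnn v (hu.1.trans hv.1.le))
  · refine mul_pos (hρ 1 (by simp)) ((hnn 1 zero_le_one).lt_of_ne fun h => hf ?_)
    rw [← integral_unitVolume, eq_comm,
      integral_eq_zero_iff_of_nonneg (fun _ => norm_nonneg _) hi] at h
    refine Lp.ext (EventuallyEq.trans ?_ (Lp.coeFn_zero ℂ 2 unitVolume).symm)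
    filter_upwards [h] with u hu
    simpa using hu

theorem norm_greenOp_pos (hρ : ∀ v ∈ Icc (0 : ℝ) 1, 0 < ρ v) : 0 < ‖greenOp ρ‖ := by
  rw [norm_pos_iff]
  intro h
  obtain ⟨f, hf⟩ := exists_ne (0 : UnitL2)
  exact hf (greenOp_injective ρ hρ f (by rw [h]; rfl))

/-- For a self-adjoint operator `‖G‖` or `-‖G‖` is in the spectrum, and nonnegativity excludes the
second; by compactness a nonzero spectral value is an eigenvalue. -/
theorem exists_eigenvector (hρ : ∀ v ∈ Icc (0 : ℝ) 1, 0 < ρ v) :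
    ∃ f : UnitL2, f ≠ 0 ∧ greenOp ρ f = ‖greenOp ρ‖ • f := by
  have hpos := norm_greenOp_pos ρ hρ
  have hG := greenOp_nonneg ρ hρ
  have hs : ‖greenOp ρ‖ ∈ spectrum ℝ (greenOp ρ) := by
    rcases CStarAlgebra.norm_or_neg_norm_mem_spectrum (IsSelfAdjoint.of_nonneg hG) with h | h
    · exact h
    · exact absurd (spectrum_nonneg_of_nonneg hG h) (by linarith)
  rw [← spectrum.algebraMap_mem_iff ℂ] at hs
  rw [← IsCompactOperator.hasEigenvalue_iff_mem_spectrum (isCompactOperator_greenOp ρ)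
    (by simpa using hpos.ne')] at hs
  obtain ⟨f, hf⟩ := hs.exists_hasEigenvector
  refine ⟨f, hf.2, ?_⟩
  have := hf.apply_eq_smul
  rw [← ofReal_smul_unitL2]
  exact this

/-- Both `g` and `|g|` are eigenvectors, so `|green ρ g| = green ρ |g|` on all of `[0, 1]` by
continuity. At `0` the right side is positive unless `g = 0`. This yields simplicity: two
eigenvectors are compared by their value at `0`. -/
theorem eigenvector_eq_zero (hρ : ∀ v ∈ Icc (0 : ℝ) 1, 0 < ρ v) {g : UnitL2}
    (hg : greenOp ρ g = ‖greenOp ρ‖ • g)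
    (h0 : green ρ g 0 = 0) : g = 0 := by
  by_contra hne
  have habs := greenOp_absL2_of_eigenvector ρ hρ hg
  have hpos := integral_green_abs_pos ρ hρ hne (u := 0) (by simp)
  have hae : (fun u => ((‖green ρ g u‖ : ℝ) : ℂ)) =ᵐ[unitVolume] green ρ (absL2 g) := by
    have h1 := Lp.coeFn_smul ‖greenOp ρ‖ g
    have h2 := Lp.coeFn_smul ‖greenOp ρ‖ (absL2 g)
    rw [← hg] at h1
    rw [← habs] at h2
    filter_upwards [h1, h2, coeFn_greenOp ρ g, coeFn_greenOp ρ (absL2 g), coeFn_absL2 g]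
      with u h1 h2 h3 h4 h5
    rw [← h3, ← h4, h1, h2, Pi.smul_apply, Pi.smul_apply, h5, norm_smul]
    simp
  have := eqOn_Icc_of_ae_unitVolume hae
    (Complex.continuous_ofReal.comp_continuousOn (continuousOn_green ρ g).norm)
    (continuousOn_green ρ (absL2 g)) (show (0 : ℝ) ∈ Icc (0 : ℝ) 1 by simp)
  rw [green_absL2 ρ g (by simp)] at this
  simp only [h0, norm_zero] at this
  exact hpos.ne (by exact_mod_cast this)

/-- The first eigenvector: it is represented by a real function, positive on `[0, 1)`, and spans
the eigenspace. -/
theorem exists_groundState (hρ : ∀ v ∈ Icc (0 : ℝ) 1, 0 < ρ v) :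
    ∃ (e : UnitL2) (y : ℝ → ℝ), ‖e‖ = 1 ∧
    greenOp ρ e = ‖greenOp ρ‖ • e ∧ (∀ u ∈ Ico (0 : ℝ) 1, 0 < y u) ∧
    (∀ u ∈ Icc (0 : ℝ) 1, green ρ e u = ((‖greenOp ρ‖ * y u : ℝ) : ℂ)) ∧
    (e =ᵐ[unitVolume] fun u => (y u : ℂ)) ∧
    ∀ k, greenOp ρ k = ‖greenOp ρ‖ • k → ∃ c : ℂ, k = c • e := by
  set μ := ‖greenOp ρ‖
  have hμ : 0 < μ := norm_greenOp_pos ρ hρ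
  obtain ⟨f₀, hf₀, hef₀⟩ := exists_eigenvector ρ hρ
  set f : UnitL2 := ‖f₀‖⁻¹ • f₀
  have hf : ‖f‖ = 1 := by
    rw [norm_smul, norm_inv, norm_norm, inv_mul_cancel₀ (norm_ne_zero_iff.2 hf₀)]
  have hf0 : f ≠ 0 := norm_ne_zero_iff.1 (by rw [hf]; exact one_ne_zero)
  have hef : greenOp ρ f = μ • f := by
    simp only [f]
    rw [← ofReal_smul_unitL2, map_smul, hef₀, smul_comm]
  have heig := greenOp_absL2_of_eigenvector ρ hρ hef
  set y : ℝ → ℝ := fun u => μ⁻¹ * ∫ v in u..1, ρ v * ∫ x in (0 : ℝ)..v, ‖f x‖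
  have hgreen : ∀ u ∈ Icc (0 : ℝ) 1, green ρ (absL2 f) u = ((μ * y u : ℝ) : ℂ) := by
    intro u hu
    rw [green_absL2 ρ f hu, mul_inv_cancel_left₀ hμ.ne']
  have hypos : ∀ u ∈ Ico (0 : ℝ) 1, 0 < y u := fun u hu =>
    mul_pos (inv_pos.2 hμ) (integral_green_abs_pos ρ hρ hf0 hu)
  refine ⟨absL2 f, y, by rw [norm_absL2, hf], heig, hypos, hgreen, ?_, fun k hk => ?_⟩
  · have h2 := Lp.coeFn_smul μ (absL2 f)
    rw [← heig] at h2
    filter_upwards [h2, coeFn_greenOp ρ (absL2 f), ae_unitVolume_of_forall (fun u hu => hu)]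
      with u h2 h3 hu
    rw [h3, hgreen u (Ioo_subset_Icc_self hu), Pi.smul_apply, Complex.ofReal_mul,
      Complex.real_smul] at h2
    exact (mul_left_cancel₀ (by exact_mod_cast hμ.ne') h2).symm
  · have h0 : (0 : ℝ) ∈ Icc (0 : ℝ) 1 := by simp
    have hne : green ρ (absL2 f) 0 ≠ 0 := by
      rw [hgreen 0 h0]
      exact_mod_cast (mul_pos hμ (hypos 0 (by simp))).ne'
    -- Chosen so that `k - c • absL2 f` has Green value `0` at the point `0`.
    set c := green ρ k 0 / green ρ (absL2 f) 0
    refine ⟨c, sub_eq_zero.1 (eigenvector_eq_zero ρ hρ ?_ ?_)⟩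
    · rw [map_sub, map_smul, hk, heig, smul_sub, smul_comm c]
    · have h1 := map_sub (greenAt ρ ⟨0, h0⟩) k (c • absL2 f)
      rw [map_smul] at h1
      simp only [greenAt_apply] at h1
      rw [h1, smul_eq_mul, div_mul_cancel₀ _ hne, sub_self]

end

/-! ### The variational formula for the decay rate. -/

noncomputable section

theorem prim_ofReal (f : ℝ → ℝ) (v : ℝ) :
    prim (fun u => (f u : ℂ)) v = ((∫ x in (0 : ℝ)..v, f x : ℝ) : ℂ) :=
  intervalIntegral.integral_ofReal

theorem green_ofReal (ρ : C(ℝ, ℝ)) (f : ℝ → ℝ) (u : ℝ) :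
    green ρ (fun u => (f u : ℂ)) u =
      ((∫ v in u..1, ρ v * ∫ x in (0 : ℝ)..v, f x : ℝ) : ℂ) := by
  simp only [green, prim_ofReal, ← Complex.ofReal_mul]
  exact intervalIntegral.integral_ofReal

theorem contDiffOn_succ_of_hasDerivWithinAt {f f' : ℝ → ℝ} {n : ℕ}
    (h : ∀ u ∈ Icc (0 : ℝ) 1, HasDerivWithinAt f (f' u) (Icc 0 1) u)
    (hf' : ContDiffOn ℝ n f' (Icc 0 1)) : ContDiffOn ℝ (n + 1 : ℕ) f (Icc 0 1) := by
  rw [Nat.cast_succ, contDiffOn_succ_iff_derivWithin uniqueDiffOn_Icc_zero_one]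
  refine ⟨fun u hu => (h u hu).differentiableWithinAt, by simp, hf'.congr fun u hu => ?_⟩
  exact (h u hu).derivWithin (uniqueDiffOn_Icc_zero_one u hu)

theorem continuousOn_integral_right {f : ℝ → ℝ} (hf : ContinuousOn f (Icc 0 1)) :
    ContinuousOn (fun v => ∫ x in (0 : ℝ)..v, f x) (Icc 0 1) :=
  fun _ hv => (hasDerivWithinAt_integral_right hf hv).continuousWithinAt

section Eigenfunction

variable {ρ : C(ℝ, ℝ)} {y : ℝ → ℝ} {μ : ℝ}

theorem hasDerivWithinAt_eigenfunction (hμ : μ ≠ 0) (hy : ContinuousOn y (Icc 0 1))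
    (h : ∀ u ∈ Icc (0 : ℝ) 1, μ * y u = ∫ v in u..1, ρ v * ∫ x in (0 : ℝ)..v, y x) {u : ℝ}
    (hu : u ∈ Icc (0 : ℝ) 1) :
    HasDerivWithinAt y (μ⁻¹ * -(ρ u * ∫ x in (0 : ℝ)..u, y x)) (Icc 0 1) u := by
  have h1 := (hasDerivWithinAt_integral_left (f := fun v => ρ v * ∫ x in (0 : ℝ)..v, y x)
    (ρ.continuous.continuousOn.mul (continuousOn_integral_right hy)) hu).const_mul μ⁻¹
  refine h1.congr_of_mem (fun v hv => ?_) hu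
  rw [← h v hv, inv_mul_cancel_left₀ hμ]

/-- Bootstrap: `y'` is a smooth multiple of the primitive of `y`, whose derivative is `y`, so both
gain one derivative together. -/
theorem contDiffOn_eigenfunction (hμ : μ ≠ 0) (hy : ContinuousOn y (Icc 0 1))
    (h : ∀ u ∈ Icc (0 : ℝ) 1, μ * y u = ∫ v in u..1, ρ v * ∫ x in (0 : ℝ)..v, y x)
    (hρ : ContDiff ℝ ∞ ρ) : ContDiffOn ℝ ∞ y (Icc 0 1) := by
  rw [contDiffOn_infty]
  intro n
  suffices H : ContDiffOn ℝ n y (Icc 0 1) ∧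
      ContDiffOn ℝ n (fun v => ∫ x in (0 : ℝ)..v, y x) (Icc 0 1) from H.1
  induction n with
  | zero =>
    simp only [Nat.cast_zero, contDiffOn_zero]
    exact ⟨hy, continuousOn_integral_right hy⟩
  | succ n ih =>
    refine ⟨contDiffOn_succ_of_hasDerivWithinAt
      (fun u hu => hasDerivWithinAt_eigenfunction hμ hy h hu) ?_,
      contDiffOn_succ_of_hasDerivWithinAt
      (fun u hu => hasDerivWithinAt_integral_right hy hu) ih.1⟩
    exact contDiffOn_const.mul ((contDiff_infty.1 hρ n).contDiffOn.mul ih.2).neg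

end Eigenfunction

variable (ρ : C(ℝ, ℝ))

theorem re_inner_greenOp_le (f : UnitL2) :
    (inner ℂ f (greenOp ρ f)).re ≤ ‖greenOp ρ‖ * ‖f‖ ^ 2 := by
  refine (Complex.re_le_norm _).trans ((norm_inner_le_norm _ _).trans ?_)
  have := (greenOp ρ).le_opNorm f
  nlinarith [norm_nonneg f]

theorem norm_toLp_ofReal_sq {f : ℝ → ℝ} (hf : MemLp (fun u => (f u : ℂ)) 2 unitVolume) :
    ‖hf.toLp‖ ^ 2 = ∫ u in (0 : ℝ)..1, f u ^ 2 := by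
  have h1 : RCLike.re (inner ℂ hf.toLp hf.toLp) = ‖hf.toLp‖ ^ 2 := inner_self_eq_norm_sq _
  have h2 : inner ℂ hf.toLp hf.toLp = ((∫ u, f u ^ 2 ∂unitVolume : ℝ) : ℂ) := by
    rw [L2.inner_def, ← integral_complex_ofReal]
    refine integral_congr_ae ?_
    filter_upwards [hf.coeFn_toLp] with u hu
    rw [hu, RCLike.inner_apply', Complex.conj_ofReal, sq, Complex.ofReal_mul]
  rw [← h1, h2, ← integral_unitVolume]
  rfl

theorem re_inner_greenOp_ofReal {f : ℝ → ℝ} (hf : MemLp (fun u => (f u : ℂ)) 2 unitVolume) :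
    (inner ℂ hf.toLp (greenOp ρ hf.toLp)).re =
      ∫ v, ρ v * (∫ x in (0 : ℝ)..v, f x) ^ 2 ∂unitVolume := by
  rw [inner_greenOp_self, Complex.ofReal_re]
  refine integral_congr_ae (ae_unitVolume_of_forall fun v hv => ?_)
  simp only
  rw [prim_congr_ae hf.coeFn_toLp (Ioo_subset_Icc_self hv), prim_ofReal, Complex.norm_real,
    Real.norm_eq_abs, sq_abs]

theorem integral_derivUnit {f : ℝ → ℝ} (hf : DifferentiableOn ℝ f (Icc 0 1))
    (hd : ContinuousOn (derivUnit f) (Icc 0 1)) {u : ℝ} (hu : u ∈ Icc (0 : ℝ) 1) :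
    ∫ v in u..1, derivUnit f v = f 1 - f u := by
  refine intervalIntegral.integral_eq_sub_of_hasDeriv_right_of_le hu.2
    (hf.continuousOn.mono (Icc_subset_Icc_left hu.1)) (fun x hx => ?_)
    (hd.mono (uIcc_subset_Icc hu (by simp))).intervalIntegrable
  have hx' : x ∈ Ioo (0 : ℝ) 1 := ⟨hu.1.trans_lt hx.1, hx.2⟩
  exact ((hf x (Ioo_subset_Icc_self hx')).hasDerivWithinAt.hasDerivAt
    (Icc_mem_nhds hx'.1 hx'.2)).hasDerivWithinAt

/-- Integration by parts; the boundary terms vanish because `ψ 1 = 0` and the primitive of `ψ`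
starts at `0`. -/
theorem integral_sq_eq_of_contDiffOn {ψ : ℝ → ℝ} (hψ : ContDiffOn ℝ ∞ ψ (Icc 0 1))
    (h1 : ψ 1 = 0) : ∫ u in (0 : ℝ)..1, ψ u ^ 2 =
      -∫ v, (∫ x in (0 : ℝ)..v, ψ x) * derivUnit ψ v ∂unitVolume := by
  have hc := hψ.continuousOn
  have hd : ContinuousOn (derivUnit ψ) (Icc 0 1) :=
    hψ.continuousOn_derivWithin uniqueDiffOn_Icc_zero_one (by simp)
  have hft : ∀ u ∈ Ioo (0 : ℝ) 1, ψ u = -∫ v in u..1, derivUnit ψ v := by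
    intro u hu
    rw [integral_derivUnit (hψ.differentiableOn (by simp)) hd (Ioo_subset_Icc_self hu), h1]
    ring
  have hs := integral_mul_integral_swap
    (f := fun u => (ψ u : ℂ)) (h := fun v => (derivUnit ψ v : ℂ))
    (integrable_unitVolume_of_continuousOn hc).ofReal
    (integrable_unitVolume_of_continuousOn hd).ofReal
  simp only [prim_ofReal, intervalIntegral.integral_ofReal, ← Complex.ofReal_mul,
    integral_complex_ofReal, Complex.ofReal_inj] at hs
  rw [← hs, ← integral_unitVolume, ← integral_neg]
  refine integral_congr_ae (ae_unitVolume_of_forall fun u hu => ?_)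
  have := hft u hu
  simp only
  rw [sq]
  nth_rewrite 2 [this]
  ring

/-- With `P` the primitive of `ψ` and `μ = ‖G‖`, `1 = ∫ ψ² = -∫ P ψ' ≤ (1 / 2μ) ∫ ρ P² + (μ / 2) ∫ A
ψ'²`. The first term is at most `1 / 2`, since `∫ ρ P² = ⟪ψ, G ψ⟫ ≤ μ`. -/
theorem inv_norm_le_energy (hρ : ∀ v ∈ Icc (0 : ℝ) 1, 0 < ρ v) {A : ℝ → ℝ}
    (hA : ∀ v ∈ Icc (0 : ℝ) 1, A v * ρ v = 1) {ψ : ℝ → ℝ} (hψ : ψ ∈ admissibleFunctions) :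
    ‖greenOp ρ‖⁻¹ ≤ ∫ v in (0 : ℝ)..1, A v * derivUnit ψ v ^ 2 := by
  obtain ⟨hsm, hn, -, h1⟩ := hψ
  have hμ := norm_greenOp_pos ρ hρ
  set μ := ‖greenOp ρ‖
  have hc := hsm.continuousOn
  have hd : ContinuousOn (derivUnit ψ) (Icc 0 1) :=
    hsm.continuousOn_derivWithin uniqueDiffOn_Icc_zero_one (by simp)
  have hA' : ContinuousOn A (Icc 0 1) := by
    refine (ρ.continuous.continuousOn.inv₀ fun v hv => (hρ v hv).ne').congr fun v hv => ?_
    exact eq_inv_of_mul_eq_one_left (hA v hv)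
  have hm : MemLp (fun u => (ψ u : ℂ)) 2 unitVolume :=
    memLp_of_continuousOn (Complex.continuous_ofReal.comp_continuousOn hc)
  have hG := re_inner_greenOp_le ρ hm.toLp
  rw [re_inner_greenOp_ofReal, norm_toLp_ofReal_sq, hn, mul_one] at hG
  have hP := continuousOn_integral_right hc
  have i1 : Integrable (fun v => (∫ x in (0 : ℝ)..v, ψ x) * derivUnit ψ v) unitVolume :=
    integrable_unitVolume_of_continuousOn (hP.mul hd)
  have i2 : Integrable (fun v => ρ v * (∫ x in (0 : ℝ)..v, ψ x) ^ 2) unitVolume :=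
    integrable_unitVolume_of_continuousOn (ρ.continuous.continuousOn.mul (hP.pow 2))
  have i3 : Integrable (fun v => A v * derivUnit ψ v ^ 2) unitVolume :=
    integrable_unitVolume_of_continuousOn (hA'.mul (hd.pow 2))
  have hle : ∫ u in (0 : ℝ)..1, ψ u ^ 2 ≤
      ∫ v, (μ⁻¹ * (ρ v * (∫ x in (0 : ℝ)..v, ψ x) ^ 2) / 2 +
        μ * (A v * derivUnit ψ v ^ 2) / 2) ∂unitVolume := by
    rw [integral_sq_eq_of_contDiffOn hsm h1, ← integral_neg]
    refine integral_mono_ae i1.neg (((i2.const_mul _).div_const _).add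
      ((i3.const_mul _).div_const _)) (ae_unitVolume_of_forall fun v hv => ?_)
    have hv' := Ioo_subset_Icc_self hv
    have e1 := hA v hv'
    have e2 := hρ v hv'
    set P := ∫ x in (0 : ℝ)..v, ψ x
    set D := derivUnit ψ v
    -- A completed square, using `A ρ = 1`; it vanishes exactly when `P = -μ A ψ'`, the eigenvalue
    -- equation.
    have e3 : μ⁻¹ * (ρ v * P ^ 2) / 2 + μ * (A v * D ^ 2) / 2 + P * D =
        ρ v * μ⁻¹ * (P + μ * A v * D) ^ 2 / 2 := by
      have : μ⁻¹ * μ = 1 := inv_mul_cancel₀ hμ.ne'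
      linear_combination -(P * D * (A v * ρ v) + μ * A v * D ^ 2 / 2 *
        (A v * ρ v)) * this - (P * D + μ * A v * D ^ 2 / 2) * e1
    have e4 : 0 ≤ ρ v * μ⁻¹ * (P + μ * A v * D) ^ 2 / 2 := by positivity
    simp only
    linarith
  rw [hn, integral_add ((i2.const_mul _).div_const _) ((i3.const_mul _).div_const _),
    integral_div, integral_div, integral_const_mul, integral_const_mul] at hle
  rw [← integral_unitVolume, inv_le_iff_one_le_mul₀ hμ]
  have : μ⁻¹ * ∫ v, ρ v * (∫ x in (0 : ℝ)..v, ψ x) ^ 2 ∂unitVolume ≤ 1 := by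
    rw [inv_mul_le_iff₀ hμ, mul_one]; exact hG
  linarith

/-- The lower bound is attained at the ground state: `y' = -μ⁻¹ ρ ∫₀ᵘ y` turns its energy into `μ⁻²
⟪e, G e⟫ = μ⁻¹`. The smoothness of `ρ` makes `y` admissible. -/
theorem decayRate_eq (hρ : ∀ v ∈ Icc (0 : ℝ) 1, 0 < ρ v) (hsm : ContDiff ℝ ∞ ρ) {A : ℝ → ℝ}
    (hA : ∀ v ∈ Icc (0 : ℝ) 1, A v * ρ v = 1) : decayRate A = ‖greenOp ρ‖⁻¹ := by
  have hμ := norm_greenOp_pos ρ hρ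
  refine IsLeast.csInf_eq ⟨?_, fun _ ⟨ψ, hψ, h⟩ => h ▸ inv_norm_le_energy ρ hρ hA hψ⟩
  obtain ⟨e, y, he1, heig, -, hgr, hey, -⟩ := exists_groundState ρ hρ
  set μ := ‖greenOp ρ‖
  have hgr' : ∀ u ∈ Icc (0 : ℝ) 1, μ * y u = ∫ v in u..1, ρ v * ∫ x in (0 : ℝ)..v, y x := by
    intro u hu
    have := hgr u hu
    rw [green_congr_ae ρ hey hu, green_ofReal, Complex.ofReal_inj] at this
    exact this.symm
  have hy : ContinuousOn y (Icc 0 1) := by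
    have : ContinuousOn (fun u => μ⁻¹ * (green ρ e u).re) (Icc 0 1) :=
      continuousOn_const.mul (Complex.continuous_re.comp_continuousOn (continuousOn_green ρ e))
    refine this.congr fun u hu => ?_
    simp only [hgr u hu, Complex.ofReal_re, inv_mul_cancel_left₀ hμ.ne']
  have hd : ∀ u ∈ Icc (0 : ℝ) 1, derivUnit y u = μ⁻¹ * -(ρ u * ∫ x in (0 : ℝ)..u, y x) :=
    fun u hu => derivUnit_eq (hasDerivWithinAt_eigenfunction hμ.ne' hy hgr' hu) hu
  have hm : MemLp (fun u => (y u : ℂ)) 2 unitVolume :=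
    memLp_of_continuousOn (Complex.continuous_ofReal.comp_continuousOn hy)
  have hem : e = hm.toLp := Lp.ext (hey.trans hm.coeFn_toLp.symm)
  refine ⟨y, ⟨contDiffOn_eigenfunction hμ.ne' hy hgr' hsm, ?_, ?_, ?_⟩, ?_⟩
  · rw [← norm_toLp_ofReal_sq hm, ← hem, he1, one_pow]
  · rw [hd 0 (by simp)]; simp
  · have := hgr' 1 (by simp)
    rw [intervalIntegral.integral_same] at this
    simpa [hμ.ne'] using this
  · have h1 := re_inner_greenOp_ofReal ρ hm
    rw [← hem, heig, ← ofReal_smul_unitL2, inner_smul_right, Complex.re_ofReal_mul] at h1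
    have h2 : (inner ℂ e e).re = ‖e‖ ^ 2 := inner_self_eq_norm_sq (𝕜 := ℂ) e
    rw [h2, he1, one_pow, mul_one] at h1
    have h3 : ∫ v in (0 : ℝ)..1, A v * derivUnit y v ^ 2 =
        ∫ v, μ⁻¹ ^ 2 * (ρ v * (∫ x in (0 : ℝ)..v, y x) ^ 2) ∂unitVolume := by
      rw [← integral_unitVolume]
      refine integral_congr_ae (ae_unitVolume_of_forall fun v hv => ?_)
      have hv' := Ioo_subset_Icc_self hv
      simp only [hd v hv']
      linear_combination (μ⁻¹ ^ 2 * ρ v * (∫ x in (0 : ℝ)..v, y x) ^ 2) * hA v hv'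
    simp only
    rw [h3, integral_const_mul, ← h1]
    field_simp

end

/-! ### Existence: the semigroup gives a classical solution. -/

noncomputable section

theorem green_sub (ρ : C(ℝ, ℝ)) (f g : UnitL2) {u : ℝ} (hu : u ∈ Icc (0 : ℝ) 1) :
    green ρ (f - g : UnitL2) u = green ρ f u - green ρ g u :=
  map_sub (greenAt ρ ⟨u, hu⟩) f g

theorem prim_sub (f g : UnitL2) {v : ℝ} (hv : v ∈ Icc (0 : ℝ) 1) :
    prim (f - g : UnitL2) v = prim f v - prim g v := by
  rw [prim_congr_ae (Lp.coeFn_sub f g) hv]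
  exact intervalIntegral.integral_sub
    (intervalIntegrable_of_unitVolume (integrable_unitL2 f) ⟨le_rfl, zero_le_one⟩ hv)
    (intervalIntegrable_of_unitVolume (integrable_unitL2 g) ⟨le_rfl, zero_le_one⟩ hv)

/-- Joint continuity follows by changing first the curve parameter, at a cost uniform in `u`, and
then the point. -/
theorem continuousOn_uncurry_of_bound {K : UnitL2 → ℝ → ℂ} {C : ℝ}
    (hK : ∀ f g, ∀ u ∈ Icc (0 : ℝ) 1, ‖K f u - K g u‖ ≤ C * ‖f - g‖)
    (hc : ∀ f, ContinuousOn (K f) (Icc 0 1)) {F : ℝ → UnitL2} (hF : ContinuousOn F (Ioi 0)) :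
    ContinuousOn (fun p : ℝ × ℝ => K (F p.1) p.2) (Ioi 0 ×ˢ Icc 0 1) := by
  rintro ⟨z, u⟩ ⟨hz, hu⟩
  have h1 : ContinuousWithinAt (fun p : ℝ × ℝ => K (F z) p.2) (Ioi 0 ×ˢ Icc 0 1) (z, u) :=
    (hc (F z) u hu).comp continuous_snd.continuousWithinAt fun p hp => hp.2
  have h2 : ContinuousWithinAt (fun p : ℝ × ℝ => F p.1) (Ioi 0 ×ˢ Icc 0 1) (z, u) :=
    (hF z hz).comp continuous_fst.continuousWithinAt fun p hp => hp.1
  have h3 : Tendsto (fun p : ℝ × ℝ => K (F p.1) p.2 - K (F z) p.2)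
      (𝓝[Ioi 0 ×ˢ Icc 0 1] (z, u)) (𝓝 0) := by
    rw [tendsto_zero_iff_norm_tendsto_zero]
    have h4 : Tendsto (fun p : ℝ × ℝ => C * ‖F p.1 - F z‖)
        (𝓝[Ioi 0 ×ˢ Icc 0 1] (z, u)) (𝓝 0) := by
      have := ((tendsto_iff_norm_sub_tendsto_zero.1 h2).const_mul C)
      rwa [mul_zero] at this
    refine squeeze_zero' (Eventually.of_forall fun _ => norm_nonneg _) ?_ h4
    filter_upwards [self_mem_nhdsWithin] with p hp
    exact hK _ _ _ hp.2
  have h5 := h3.add h1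
  simp only [sub_add_cancel, zero_add] at h5
  exact h5

theorem continuousOn_green_uncurry (ρ : C(ℝ, ℝ)) {F : ℝ → UnitL2} (hF : ContinuousOn F (Ioi 0)) :
    ContinuousOn (fun p : ℝ × ℝ => green ρ (F p.1) p.2) (Ioi 0 ×ˢ Icc 0 1) :=
  continuousOn_uncurry_of_bound (K := fun f => green ρ f) (C := supUnit ρ)
    (fun f g u hu => by rw [← green_sub ρ f g hu]; exact norm_green_le ρ _ hu)
    (continuousOn_green ρ) hF

theorem continuousOn_prim_uncurry {F : ℝ → UnitL2} (hF : ContinuousOn F (Ioi 0)) :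
    ContinuousOn (fun p : ℝ × ℝ => prim (F p.1) p.2) (Ioi 0 ×ˢ Icc 0 1) :=
  continuousOn_uncurry_of_bound (K := fun f => prim f) (C := 1)
    (fun f g u hu => by
      rw [← prim_sub f g hu, one_mul]; exact norm_prim_unitL2_le _ hu)
    (fun f => continuousOn_prim (integrable_unitL2 f)) hF

theorem hasDerivWithinAt_re_green (ρ : C(ℝ, ℝ)) (f : UnitL2) {u : ℝ} (hu : u ∈ Icc (0 : ℝ) 1) :
    HasDerivWithinAt (fun u => (green ρ f u).re) (-(ρ u * (prim f u).re)) (Icc 0 1) u := by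
  have h := hasDerivWithinAt_integral_left (continuousOn_green_integrand ρ (integrable_unitL2 f)) hu
  have h2 := Complex.reCLM.hasFDerivAt.comp_hasDerivWithinAt u h
  refine h2.congr_deriv ?_
  simp

variable (ρ : C(ℝ, ℝ)) (f : UnitL2)

/-- The orbit of `f` under `G⁻ᵐ exp (-z G⁻¹)` with `G = greenOp ρ`. -/
def heatOrbit (m : ℕ) (z : ℝ) : UnitL2 := heatOp (greenOp ρ) m z f

theorem hasDerivAt_heatOrbit (m : ℕ) {z : ℝ} (hz : 0 < z) :
    HasDerivAt (heatOrbit ρ f m) (-heatOrbit ρ f (m + 1) z) z := by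
  have h := hasDerivAt_heatOp (greenOp ρ) m hz
  exact ((ContinuousLinearMap.apply ℂ UnitL2 f).restrictScalars ℝ).hasFDerivAt.comp_hasDerivAt z h

theorem continuousOn_heatOrbit (m : ℕ) : ContinuousOn (heatOrbit ρ f m) (Ioi 0) :=
  fun _ hz => (hasDerivAt_heatOrbit ρ f m hz).continuousAt.continuousWithinAt

theorem greenOp_heatOrbit_succ (hρ : ∀ v ∈ Icc (0 : ℝ) 1, 0 < ρ v) (m : ℕ) {z : ℝ} (hz : 0 < z) :
    greenOp ρ (heatOrbit ρ f (m + 1) z) = heatOrbit ρ f m z := by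
  have h := mul_heatOp_succ (greenOp ρ) (IsSelfAdjoint.of_nonneg (greenOp_nonneg ρ hρ)) m hz
  exact congrArg (fun B : UnitL2 →L[ℂ] UnitL2 => B f) h

/-- Raising the order by one supplies a continuous representative of the `L²` class. Pointwise
values come from order `1`, the derivative in `z` from order `2`. -/
theorem coeFn_heatOrbit (hρ : ∀ v ∈ Icc (0 : ℝ) 1, 0 < ρ v) (m : ℕ) {z : ℝ} (hz : 0 < z) :
    heatOrbit ρ f m z =ᵐ[unitVolume] green ρ (heatOrbit ρ f (m + 1) z) := by
  rw [← greenOp_heatOrbit_succ ρ f hρ m hz]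
  exact coeFn_greenOp ρ _

/-- The classical solution of the diffusion problem given by the semigroup. -/
def heatSolution (φ : ℝ → ℝ) (z u : ℝ) : ℝ :=
  if 0 < z then (green ρ (heatOrbit ρ f 1 z) u).re else φ u

theorem heatSolution_of_pos (φ : ℝ → ℝ) {z : ℝ} (hz : 0 < z) :
    heatSolution ρ f φ z = fun u => (green ρ (heatOrbit ρ f 1 z) u).re := by
  funext u
  rw [heatSolution, if_pos hz]

theorem derivUnit_heatSolution (φ : ℝ → ℝ) {z u : ℝ} (hz : 0 < z) (hu : u ∈ Icc (0 : ℝ) 1) :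
    derivUnit (heatSolution ρ f φ z) u = -(ρ u * (prim (heatOrbit ρ f 1 z) u).re) := by
  rw [heatSolution_of_pos ρ f φ hz]
  exact derivUnit_eq (hasDerivWithinAt_re_green ρ _ hu) hu

theorem hasDerivAt_heatSolution (φ : ℝ → ℝ) {z u : ℝ} (hz : 0 < z) (hu : u ∈ Icc (0 : ℝ) 1) :
    HasDerivAt (fun s => heatSolution ρ f φ s u) (-(green ρ (heatOrbit ρ f 2 z) u).re) z := by
  have h1 := (((greenAt ρ ⟨u, hu⟩).restrictScalars ℝ).hasFDerivAt.comp_hasDerivAt z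
    (hasDerivAt_heatOrbit ρ f 1 hz))
  have h2 := Complex.reCLM.hasFDerivAt.comp_hasDerivAt z h1
  refine (h2.congr_of_eventuallyEq ?_).congr_deriv ?_
  · filter_upwards [Ioi_mem_nhds hz] with s hs
    simp only [heatSolution_of_pos ρ f φ hs]
    rfl
  · rw [map_neg, map_neg]
    rfl

/-- The flux is minus the primitive of the orbit of order `1`, represented continuously by `green`
of order `2`. Its derivative is therefore the same expression as the derivative in `z`. -/
theorem hasDerivAt_flux_heatSolution (hρ : ∀ v ∈ Icc (0 : ℝ) 1, 0 < ρ v) {A : ℝ → ℝ}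
    (hA : ∀ v ∈ Icc (0 : ℝ) 1, A v * ρ v = 1) (φ : ℝ → ℝ) {z u : ℝ} (hz : 0 < z)
    (hu : u ∈ Ioo (0 : ℝ) 1) :
    HasDerivAt (fun v => A v * derivUnit (heatSolution ρ f φ z) v)
      (-(green ρ (heatOrbit ρ f 2 z) u).re) u := by
  have hnhds := Icc_mem_nhds hu.1 hu.2
  have h1 : HasDerivAt (prim (green ρ (heatOrbit ρ f 2 z))) (green ρ (heatOrbit ρ f 2 z) u) u :=
    (hasDerivWithinAt_integral_right (continuousOn_green ρ _)
      (Ioo_subset_Icc_self hu)).hasDerivAt hnhds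
  have h2 := (Complex.reCLM.hasFDerivAt.comp_hasDerivAt u h1).neg
  refine h2.congr_of_eventuallyEq ?_
  filter_upwards [hnhds] with v hv
  rw [derivUnit_heatSolution ρ f φ hz hv, prim_congr_ae (coeFn_heatOrbit ρ f hρ 1 hz) hv,
    mul_neg, ← mul_assoc, hA v hv, one_mul]
  rfl

theorem tendsto_heatOrbit_zero (hρ : ∀ v ∈ Icc (0 : ℝ) 1, 0 < ρ v) :
    Tendsto (heatOrbit ρ f 0) (𝓝[>] 0) (𝓝 f) :=
  tendsto_heatOp_zero (greenOp ρ) (greenOp_nonneg ρ hρ) (greenOp_injective ρ hρ) f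

theorem isDiffusionSolution_heatSolution (hρ : ∀ v ∈ Icc (0 : ℝ) 1, 0 < ρ v) {A : ℝ → ℝ}
    (hA : ∀ v ∈ Icc (0 : ℝ) 1, A v * ρ v = 1) {φ : ℝ → ℝ}
    (hφ : MemLp (fun u => (φ u : ℂ)) 2 unitVolume) :
    IsDiffusionSolution A φ (heatSolution ρ hφ.toLp φ) where
  continuousOn := by
    refine (Complex.continuous_re.comp_continuousOn
      (continuousOn_green_uncurry ρ (continuousOn_heatOrbit ρ hφ.toLp 1))).congr fun p hp => ?_
    rw [heatSolution_of_pos ρ _ φ hp.1]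
    rfl
  differentiable_u z hz u hu := by
    rw [heatSolution_of_pos ρ _ φ hz]
    exact (hasDerivWithinAt_re_green ρ _ hu).differentiableWithinAt
  continuousOn_u := by
    have h := Complex.continuous_re.comp_continuousOn
      (continuousOn_prim_uncurry (continuousOn_heatOrbit ρ hφ.toLp 1))
    refine ((((ρ.continuous.comp continuous_snd).continuousOn).mul h).neg).congr fun p hp => ?_
    rw [derivUnit_heatSolution ρ _ φ hp.1 hp.2]
    rfl
  differentiable_flux z hz u hu :=
    (hasDerivAt_flux_heatSolution ρ _ hρ hA φ hz hu).differentiableAt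
  differentiable_z z hz u hu :=
    (hasDerivAt_heatSolution ρ _ φ hz (Ioo_subset_Icc_self hu)).differentiableAt
  continuousOn_z := by
    have h := Complex.continuous_re.comp_continuousOn
      (continuousOn_green_uncurry ρ (continuousOn_heatOrbit ρ hφ.toLp 2))
    refine ((h.mono (prod_mono_right Ioo_subset_Icc_self)).neg).congr fun p hp => ?_
    rw [(hasDerivAt_heatSolution ρ _ φ hp.1 (Ioo_subset_Icc_self hp.2)).deriv]
    rfl
  equation z hz u hu := by
    rw [(hasDerivAt_heatSolution ρ _ φ hz (Ioo_subset_Icc_self hu)).deriv,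
      (hasDerivAt_flux_heatSolution ρ _ hρ hA φ hz hu).deriv]
  neumann z hz := by
    rw [derivUnit_heatSolution ρ _ φ hz (by simp)]
    simp [prim]
  dirichlet z hz := by
    rw [heatSolution_of_pos ρ _ φ hz]
    simp [green_one]
  initial := by
    refine ae_of_all _ fun u => ?_
    rw [heatSolution, if_neg (lt_irrefl _)]
  initial_limit := by
    have h1 := tendsto_iff_norm_sub_tendsto_zero.1 (tendsto_heatOrbit_zero ρ hφ.toLp hρ)
    have h2 := ENNReal.tendsto_ofReal h1
    rw [ENNReal.ofReal_zero] at h2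
    refine tendsto_of_tendsto_of_tendsto_of_le_of_le' tendsto_const_nhds h2
      (Eventually.of_forall fun _ => zero_le) ?_
    -- Taking real parts is a contraction, so the error is at most the `L²` distance of the orbit of
    -- order `0` from the initial value.
    filter_upwards [self_mem_nhdsWithin] with z hz
    rw [ofReal_norm, Lp.enorm_def]
    refine eLpNorm_mono_ae ?_
    filter_upwards [coeFn_heatOrbit ρ hφ.toLp hρ 0 hz, hφ.coeFn_toLp,
      Lp.coeFn_sub (heatOrbit ρ hφ.toLp 0 z) hφ.toLp] with u h3 h4 h5
    rw [h5, Pi.sub_apply, h3, h4, heatSolution_of_pos ρ _ φ hz]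
    simpa using Complex.abs_re_le_norm
      (green ρ (heatOrbit ρ hφ.toLp (0 + 1) z) u - (φ u : ℂ))

end

/-! ### Uniqueness: every classical solution is the semigroup solution. -/

noncomputable section

theorem integral_swap_of_continuousOn {g : ℝ → ℝ → ℝ} {a b c d : ℝ}
    (hg : ContinuousOn (fun p : ℝ × ℝ => g p.1 p.2) (uIcc a b ×ˢ uIcc c d)) :
    ∫ x in a..b, ∫ y in c..d, g x y = ∫ y in c..d, ∫ x in a..b, g x y :=
  intervalIntegral_intervalIntegral_swap
    ((hg.integrableOn_compact (isCompact_uIcc.prod isCompact_uIcc)).mono_set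
      (prod_mono uIoc_subset_uIcc uIoc_subset_uIcc))

theorem continuousOn_integral_of_continuousOn {g : ℝ → ℝ → ℝ} {a b : ℝ} (hab : a ≤ b)
    (hg : ContinuousOn (fun p : ℝ × ℝ => g p.1 p.2) (Icc a b ×ˢ Icc 0 1)) :
    ContinuousOn (fun u => ∫ z in a..b, g z u) (Icc 0 1) := by
  -- Projecting onto the intervals makes the integrand continuous everywhere without changing it on
  -- the rectangle.
  have hc : Continuous (Function.uncurry fun u z =>
      g (projIcc a b hab z) (projIcc (0 : ℝ) 1 zero_le_one u)) := by
    refine hg.comp_continuous (f := fun p : ℝ × ℝ =>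
      (((projIcc a b hab p.2 : ℝ)), (projIcc (0 : ℝ) 1 zero_le_one p.1 : ℝ))) ?_ fun p => ?_
    · exact (continuous_subtype_val.comp (continuous_projIcc.comp continuous_snd)).prodMk
        (continuous_subtype_val.comp (continuous_projIcc.comp continuous_fst))
    · exact ⟨(projIcc a b hab p.2).2, (projIcc (0 : ℝ) 1 zero_le_one p.1).2⟩
  refine (intervalIntegral.continuous_parametric_intervalIntegral_of_continuous' (μ := volume)
    hc a b).continuousOn.congr fun u hu => ?_
  refine intervalIntegral.integral_congr fun z hz => ?_
  rw [uIcc_of_le hab] at hz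
  simp only [projIcc_of_mem hab hz, projIcc_of_mem zero_le_one hu]

section Solution

variable {A φ : ℝ → ℝ} {T : ℝ → ℝ → ℝ} {ρ : C(ℝ, ℝ)}

theorem IsDiffusionSolution.continuousOn_slice (hT : IsDiffusionSolution A φ T) {z : ℝ}
    (hz : 0 < z) : ContinuousOn (T z) (Icc 0 1) :=
  hT.continuousOn.comp (f := fun u => (z, u)) (by fun_prop) fun _ hu => ⟨hz, hu⟩

theorem IsDiffusionSolution.continuousOn_derivUnit (hT : IsDiffusionSolution A φ T) {z : ℝ}
    (hz : 0 < z) : ContinuousOn (derivUnit (T z)) (Icc 0 1) :=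
  hT.continuousOn_u.comp (f := fun u => (z, u)) (by fun_prop) fun _ hu => ⟨hz, hu⟩

/-- The conservation law on a closed rectangle inside the open strip, where `∂T/∂z` is continuous
and Fubini applies. -/
theorem IsDiffusionSolution.integral_sub_interior (hT : IsDiffusionSolution A φ T) {r s a b : ℝ}
    (hr : 0 < r) (hrs : r ≤ s) (ha : a ∈ Ioo (0 : ℝ) 1) (hb : b ∈ Ioo (0 : ℝ) 1) (hab : a ≤ b) :
    ∫ x in a..b, (T s x - T r x) =
      (∫ z in r..s, A b * derivUnit (T z) b) - ∫ z in r..s, A a * derivUnit (T z) a := by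
  have hIab : uIcc a b ⊆ Ioo 0 1 := by
    rw [uIcc_of_le hab]; exact fun x hx => ⟨ha.1.trans_le hx.1, hx.2.trans_lt hb.2⟩
  have hIrs : uIcc r s ⊆ Ioi 0 := by
    rw [uIcc_of_le hrs]; exact fun x hx => hr.trans_le hx.1
  have hcz : ContinuousOn (fun p : ℝ × ℝ => deriv (fun s => T s p.2) p.1)
      (uIcc r s ×ˢ uIcc a b) := hT.continuousOn_z.mono (prod_mono hIrs hIab)
  have h1 : ∀ x ∈ uIcc a b, T s x - T r x = ∫ z in r..s, deriv (fun s => T s x) z := by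
    intro x hx
    rw [intervalIntegral.integral_deriv_eq_sub]
    · exact fun z hz => hT.differentiable_z z (hIrs hz) x (hIab hx)
    · exact (hcz.comp (f := fun z => (z, x)) (by fun_prop) fun z hz => ⟨hz, hx⟩).intervalIntegrable
  have h2 : ∀ z ∈ uIcc r s, ∫ x in a..b, deriv (fun s => T s x) z =
      A b * derivUnit (T z) b - A a * derivUnit (T z) a := by
    intro z hz
    have hc : ContinuousOn (fun x => deriv (fun s => T s x) z) (uIcc a b) :=
      hcz.comp (f := fun x => (z, x)) (by fun_prop) fun x hx => ⟨hz, hx⟩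
    have he : EqOn (fun x => deriv (fun s => T s x) z)
        (deriv fun v => A v * derivUnit (T z) v) (uIcc a b) :=
      fun x hx => hT.equation z (hIrs hz) x (hIab hx)
    rw [intervalIntegral.integral_congr he, intervalIntegral.integral_deriv_eq_sub]
    · exact fun x hx => hT.differentiable_flux z (hIrs hz) x (hIab hx)
    · exact (hc.congr he.symm).intervalIntegrable
  have hJ : ∀ v ∈ Ioo (0 : ℝ) 1, IntervalIntegrable (fun z => A v * derivUnit (T z) v)
      volume r s := fun v hv =>
    (continuousOn_const.mul (hT.continuousOn_u.comp (f := fun z => (z, v)) (by fun_prop)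
      fun z hz => ⟨hIrs hz, Ioo_subset_Icc_self hv⟩)).intervalIntegrable
  rw [intervalIntegral.integral_congr h1,
    ← integral_swap_of_continuousOn (g := fun z x => deriv (fun s => T s x) z) hcz,
    intervalIntegral.integral_congr h2, intervalIntegral.integral_sub (hJ b hb) (hJ a ha)]

/-- The equation is available only for `u` in `(0, 1)`, so the left edge is moved to `0` in the
limit; the flux is continuous up to the boundary and vanishes there by the Neumann condition. -/
theorem IsDiffusionSolution.integral_sub (hT : IsDiffusionSolution A φ T)
    (hA : ContinuousOn A (Icc 0 1)) {r s b : ℝ}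
    (hr : 0 < r) (hrs : r ≤ s) (hb : b ∈ Ioo (0 : ℝ) 1) :
    ∫ x in (0 : ℝ)..b, (T s x - T r x) = A b * ∫ z in r..s, derivUnit (T z) b := by
  have hN : ContinuousOn (fun u => A u * ∫ z in r..s, derivUnit (T z) u) (Icc 0 1) :=
    hA.mul (continuousOn_integral_of_continuousOn (g := fun z u => derivUnit (T z) u) hrs
      (hT.continuousOn_u.mono (prod_mono_left fun z hz => hr.trans_le hz.1)))
  have hD : ContinuousOn (fun x => T s x - T r x) (Icc 0 1) :=
    (hT.continuousOn_slice (hr.trans_le hrs)).sub (hT.continuousOn_slice hr)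
  have hF := (continuousOn_integral_right hD).sub hN
  have h0 : A 0 * ∫ z in r..s, derivUnit (T z) 0 = 0 := by
    have : EqOn (fun z => derivUnit (T z) 0) (fun _ => 0) (uIcc r s) := fun z hz => by
      rw [uIcc_of_le hrs] at hz
      exact hT.neumann z (hr.trans_le hz.1)
    rw [intervalIntegral.integral_congr this]
    simp
  have hint : ∀ c ∈ Icc (0 : ℝ) 1, ∀ d ∈ Icc (0 : ℝ) 1,
      IntervalIntegrable (fun x => T s x - T r x) volume c d := fun c hc d hd =>
    (hD.mono (uIcc_subset_Icc hc hd)).intervalIntegrable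
  have hev : ∀ᶠ a in 𝓝[>] (0 : ℝ), (∫ x in (0 : ℝ)..a, (T s x - T r x)) -
      A a * ∫ z in r..s, derivUnit (T z) a =
      (∫ x in (0 : ℝ)..b, (T s x - T r x)) - A b * ∫ z in r..s, derivUnit (T z) b := by
    filter_upwards [Ioo_mem_nhdsGT hb.1] with a ha
    have ha' : a ∈ Ioo (0 : ℝ) 1 := ⟨ha.1, ha.2.trans hb.2⟩
    have h := hT.integral_sub_interior hr hrs ha' hb ha.2.le
    rw [intervalIntegral.integral_const_mul, intervalIntegral.integral_const_mul] at h
    have h2 := intervalIntegral.integral_add_adjacent_intervals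
      (hint 0 (by simp) a (Ioo_subset_Icc_self ha'))
      (hint a (Ioo_subset_Icc_self ha') b (Ioo_subset_Icc_self hb))
    linarith
  have hlim : Tendsto (fun a => (∫ x in (0 : ℝ)..a, (T s x - T r x)) -
      A a * ∫ z in r..s, derivUnit (T z) a) (𝓝[>] 0) (𝓝 0) := by
    have h := hF 0 (by simp)
    have hle : 𝓝[>] (0 : ℝ) ≤ 𝓝[Icc 0 1] 0 := by
      rw [← nhdsWithin_Ioo_eq_nhdsGT (zero_lt_one (α := ℝ))]
      exact nhdsWithin_mono _ Ioo_subset_Icc_self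
    have h2 := Tendsto.mono_left h hle
    simp only [Pi.sub_apply, intervalIntegral.integral_same, h0, sub_zero] at h2
    exact h2
  have := tendsto_nhds_unique (tendsto_const_nhds.congr' (EventuallyEq.symm hev)) hlim
  linarith

/-- The equation with both `u`-derivatives integrated away: multiply the conservation law by `ρ`,
integrate over `[u, 1]`, and use the Dirichlet condition. -/
theorem IsDiffusionSolution.integral_green_sub (hT : IsDiffusionSolution A φ T)
    (hA : ∀ v ∈ Icc (0 : ℝ) 1, A v * ρ v = 1) (hAc : ContinuousOn A (Icc 0 1)) {r s u : ℝ}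
    (hr : 0 < r) (hrs : r ≤ s) (hu : u ∈ Icc (0 : ℝ) 1) :
    ∫ v in u..1, ρ v * ∫ x in (0 : ℝ)..v, (T s x - T r x) = -∫ z in r..s, T z u := by
  have hIrs : uIcc r s ⊆ Ioi 0 := by
    rw [uIcc_of_le hrs]; exact fun x hx => hr.trans_le hx.1
  have h1 : ∫ v in u..1, ρ v * ∫ x in (0 : ℝ)..v, (T s x - T r x) =
      ∫ v in u..1, ∫ z in r..s, derivUnit (T z) v := by
    rw [intervalIntegral.integral_of_le hu.2, intervalIntegral.integral_of_le hu.2,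
      integral_Ioc_eq_integral_Ioo, integral_Ioc_eq_integral_Ioo]
    refine setIntegral_congr_fun measurableSet_Ioo fun v hv => ?_
    have hv' : v ∈ Ioo (0 : ℝ) 1 := ⟨hu.1.trans_lt hv.1, hv.2⟩
    simp only [hT.integral_sub hAc hr hrs hv']
    rw [← mul_assoc, mul_comm (ρ v), hA v (Ioo_subset_Icc_self hv'), one_mul]
  rw [h1, ← integral_swap_of_continuousOn (g := fun z v => derivUnit (T z) v)
    (hT.continuousOn_u.mono (prod_mono hIrs (uIcc_subset_Icc hu (by simp)))),
    ← intervalIntegral.integral_neg]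
  refine intervalIntegral.integral_congr fun z hz => ?_
  rw [integral_derivUnit (hT.differentiable_u z (hIrs hz)) (hT.continuousOn_derivUnit (hIrs hz)) hu,
    hT.dirichlet z (hIrs hz), zero_sub]

theorem IsDiffusionSolution.memLp_slice (hT : IsDiffusionSolution A φ T) {z : ℝ} (hz : 0 < z) :
    MemLp (fun u => (T z u : ℂ)) 2 unitVolume :=
  memLp_of_continuousOn (Complex.continuous_ofReal.comp_continuousOn (hT.continuousOn_slice hz))

/-- A solution as a curve in `L²(0, 1)`. -/
def IsDiffusionSolution.orbit (hT : IsDiffusionSolution A φ T) (z : ℝ) : UnitL2 :=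
  if hz : 0 < z then (hT.memLp_slice hz).toLp else 0

theorem IsDiffusionSolution.coeFn_orbit (hT : IsDiffusionSolution A φ T) {z : ℝ} (hz : 0 < z) :
    hT.orbit z =ᵐ[unitVolume] fun u => (T z u : ℂ) := by
  rw [orbit, dif_pos hz]
  exact (hT.memLp_slice hz).coeFn_toLp

theorem IsDiffusionSolution.green_orbit_sub (hT : IsDiffusionSolution A φ T)
    (hA : ∀ v ∈ Icc (0 : ℝ) 1, A v * ρ v = 1) (hAc : ContinuousOn A (Icc 0 1)) {r s u : ℝ}
    (hr : 0 < r) (hs : 0 < s) (hu : u ∈ Icc (0 : ℝ) 1) :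
    green ρ (hT.orbit s) u - green ρ (hT.orbit r) u = -((∫ z in r..s, T z u : ℝ) : ℂ) := by
  wlog hrs : r ≤ s generalizing r s
  · rw [intervalIntegral.integral_symm, ← neg_sub, this hs hr (le_of_not_ge hrs)]
    simp
  rw [← green_sub ρ _ _ hu, ← Complex.ofReal_neg, ← hT.integral_green_sub hA hAc hr hrs hu,
    ← green_ofReal]
  refine green_congr_ae ρ ?_ hu
  filter_upwards [Lp.coeFn_sub (hT.orbit s) (hT.orbit r), hT.coeFn_orbit hs, hT.coeFn_orbit hr]
    with x h1 h2 h3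
  rw [h1, Pi.sub_apply, h2, h3, Complex.ofReal_sub]

/-- The integrated equation is differentiated in `z`. Uniform continuity of `T` on a compact time
window makes the error at most `ε |s - z|` for all `u` at once, hence in `L²`; no control of `∂T/∂z`
at the boundary is needed. -/
theorem IsDiffusionSolution.hasDerivAt_greenOp_orbit (hT : IsDiffusionSolution A φ T)
    (hA : ∀ v ∈ Icc (0 : ℝ) 1, A v * ρ v = 1) (hAc : ContinuousOn A (Icc 0 1)) {z : ℝ}
    (hz : 0 < z) : HasDerivAt (fun s => greenOp ρ (hT.orbit s)) (-hT.orbit z) z := by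
  rw [hasDerivAt_iff_isLittleO, Asymptotics.isLittleO_iff]
  intro ε hε
  have huc : UniformContinuousOn (fun p : ℝ × ℝ => T p.1 p.2) (Icc (z / 2) (2 * z) ×ˢ Icc 0 1) :=
    (isCompact_Icc.prod isCompact_Icc).uniformContinuousOn_of_continuous
      (hT.continuousOn.mono (prod_mono_left fun x hx => (half_pos hz).trans_le hx.1))
  rw [Metric.uniformContinuousOn_iff] at huc
  obtain ⟨δ, hδ, hd⟩ := huc ε hε
  filter_upwards [Metric.ball_mem_nhds z hδ, Icc_mem_nhds (show z / 2 < z by linarith)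
    (show z < 2 * z by linarith)] with s hs hs2
  have hs0 : 0 < s := (half_pos hz).trans_le hs2.1
  have hz2 : z ∈ Icc (z / 2) (2 * z) := ⟨by linarith, by linarith⟩
  have hclose : ∀ u ∈ Icc (0 : ℝ) 1, ∀ x ∈ uIcc z s, |T x u - T z u| ≤ ε := by
    intro u hu x hx
    have hx2 := uIcc_subset_Icc hz2 hs2 hx
    refine (hd (x, u) ⟨hx2, hu⟩ (z, u) ⟨hz2, hu⟩ ?_).le
    rw [Prod.dist_eq, dist_self, max_eq_left dist_nonneg, Real.dist_eq]
    exact (abs_sub_left_of_mem_uIcc hx).trans_lt hs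
  refine (Lp.norm_le_of_ae_bound (C := ε * ‖s - z‖) (by positivity) ?_).trans_eq
    (by simp [measureUnivNNReal])
  filter_upwards [Lp.coeFn_sub (greenOp ρ (hT.orbit s) - greenOp ρ (hT.orbit z))
      ((s - z) • -hT.orbit z), Lp.coeFn_sub (greenOp ρ (hT.orbit s)) (greenOp ρ (hT.orbit z)),
    Lp.coeFn_smul (s - z) (-hT.orbit z), Lp.coeFn_neg (hT.orbit z), hT.coeFn_orbit hz,
    coeFn_greenOp ρ (hT.orbit s), coeFn_greenOp ρ (hT.orbit z),
    ae_unitVolume_of_forall (fun u hu => hu)] with u h1 h2 h3 h4 h5 h6 h7 hu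
  have hu' := Ioo_subset_Icc_self hu
  have hint : IntervalIntegrable (fun x => T x u) volume z s :=
    (hT.continuousOn.comp (f := fun x => (x, u)) (by fun_prop) fun x hx =>
      ⟨(half_pos hz).trans_le (uIcc_subset_Icc hz2 hs2 hx).1, hu'⟩).intervalIntegrable
  have h8 : ∫ x in z..s, (T x u - T z u) = (∫ x in z..s, T x u) - (s - z) * T z u := by
    rw [intervalIntegral.integral_sub hint intervalIntegrable_const,
      intervalIntegral.integral_const, smul_eq_mul]
  have h9 := intervalIntegral.norm_integral_le_of_norm_le_const (C := ε)
    (f := fun x => T x u - T z u) (a := z) (b := s)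
    fun x hx => hclose u hu' x (uIoc_subset_uIcc hx)
  rw [h8] at h9
  have h10 : (greenOp ρ (hT.orbit s) - greenOp ρ (hT.orbit z) -
      (s - z) • -hT.orbit z : UnitL2) u =
      ((-((∫ x in z..s, T x u) - (s - z) * T z u) : ℝ) : ℂ) := by
    rw [h1, Pi.sub_apply, h2, Pi.sub_apply, h3, Pi.smul_apply, h4, Pi.neg_apply, h5, h6, h7,
      hT.green_orbit_sub hA hAc hz hs0 hu']
    simp only [Complex.real_smul, Complex.ofReal_neg, Complex.ofReal_sub, Complex.ofReal_mul]
    ring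
  rw [h10, Complex.norm_real, norm_neg]
  exact h9

theorem IsDiffusionSolution.tendsto_orbit (hT : IsDiffusionSolution A φ T)
    (hφ : MemLp (fun u => (φ u : ℂ)) 2 unitVolume) :
    Tendsto hT.orbit (𝓝[>] 0) (𝓝 hφ.toLp) := by
  rw [tendsto_iff_norm_sub_tendsto_zero]
  have h := (ENNReal.tendsto_toReal ENNReal.zero_ne_top).comp hT.initial_limit
  refine Tendsto.congr' ?_ h
  filter_upwards [self_mem_nhdsWithin] with z hz
  rw [Lp.norm_def, Function.comp]
  congr 1
  refine eLpNorm_congr_norm_ae ?_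
  filter_upwards [Lp.coeFn_sub (hT.orbit z) hφ.toLp, hT.coeFn_orbit hz, hφ.coeFn_toLp]
    with u h1 h2 h3
  rw [h1, Pi.sub_apply, h2, h3, ← Complex.ofReal_sub, Complex.norm_real]

/-- Both curves satisfy `(G w)' = -w` with the same initial limit, so the energy argument gives
equality in `L²`, and continuity makes it pointwise on `[0, 1]`. -/
theorem IsDiffusionSolution.eq_heat (hT : IsDiffusionSolution A φ T)
    (hρ : ∀ v ∈ Icc (0 : ℝ) 1, 0 < ρ v)
    (hA : ∀ v ∈ Icc (0 : ℝ) 1, A v * ρ v = 1) (hAc : ContinuousOn A (Icc 0 1))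
    (hφ : MemLp (fun u => (φ u : ℂ)) 2 unitVolume) {z u : ℝ} (hz : 0 < z)
    (hu : u ∈ Icc (0 : ℝ) 1) :
    (T z u : ℂ) = green ρ (heatOrbit ρ hφ.toLp 1 z) u := by
  have hzero : ∀ s, 0 < s → hT.orbit s - heatOrbit ρ hφ.toLp 0 s = 0 := fun s hs => by
    refine eq_zero_of_hasDerivAt_neg (greenOp ρ) (greenOp_nonneg ρ hρ) (greenOp_injective ρ hρ)
      (w := fun s => hT.orbit s - heatOrbit ρ hφ.toLp 0 s) (fun s hs => ?_) ?_ hs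
    · have h1 := hT.hasDerivAt_greenOp_orbit hA hAc hs
      have h2 := ((greenOp ρ).restrictScalars ℝ).hasFDerivAt.comp_hasDerivAt s
        (hasDerivAt_heatOrbit ρ hφ.toLp 0 hs)
      have h3 := h1.sub h2
      refine (h3.congr_of_eventuallyEq (Eventually.of_forall fun t => ?_)).congr_deriv ?_
      · exact map_sub _ _ _
      · have h4 : greenOp ρ (-heatOrbit ρ hφ.toLp (0 + 1) s) = -heatOrbit ρ hφ.toLp 0 s := by
          rw [map_neg, greenOp_heatOrbit_succ ρ _ hρ 0 hs]
        refine (congrArg (fun x => -hT.orbit s - x) h4).trans ?_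
        abel
    · have := (hT.tendsto_orbit hφ).sub (tendsto_heatOrbit_zero ρ hφ.toLp hρ)
      rwa [sub_self] at this
  have h1 := sub_eq_zero.1 (hzero z hz)
  have hae : (fun u => (T z u : ℂ)) =ᵐ[unitVolume] green ρ (heatOrbit ρ hφ.toLp 1 z) := by
    refine (hT.coeFn_orbit hz).symm.trans ?_
    rw [h1]
    exact coeFn_heatOrbit ρ _ hρ 0 hz
  exact eqOn_Icc_of_ae_unitVolume hae
    (Complex.continuous_ofReal.comp_continuousOn (hT.continuousOn_slice hz))
    (continuousOn_green ρ _) hu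

end Solution

end

/-! ### Long-time asymptotics at a point. -/

noncomputable section

section Asymptotics

variable {A φ : ℝ → ℝ} {T : ℝ → ℝ → ℝ} {ρ : C(ℝ, ℝ)}

theorem inner_ofReal_toLp {e : UnitL2} {y : ℝ → ℝ} (hey : e =ᵐ[unitVolume] fun u => (y u : ℂ))
    (hφ : MemLp (fun u => (φ u : ℂ)) 2 unitVolume) :
    inner ℂ e hφ.toLp = ((∫ u, y u * φ u ∂unitVolume : ℝ) : ℂ) := by
  rw [L2.inner_def, ← integral_complex_ofReal]
  refine integral_congr_ae ?_
  filter_upwards [hey, hφ.coeFn_toLp] with u h1 h2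
  rw [h1, h2, RCLike.inner_apply', Complex.conj_ofReal, Complex.ofReal_mul]

theorem integral_mul_pos {e : UnitL2} {y : ℝ → ℝ} (hey : e =ᵐ[unitVolume] fun u => (y u : ℂ))
    (hy : ∀ u ∈ Ico (0 : ℝ) 1, 0 < y u) (hφ : MemLp (fun u => (φ u : ℂ)) 2 unitVolume)
    (h0 : ∀ᵐ u ∂unitVolume, 0 ≤ φ u) (hne : ¬ ∀ᵐ u ∂unitVolume, φ u = 0) :
    0 < ∫ u, y u * φ u ∂unitVolume := by
  have hnn : 0 ≤ᵐ[unitVolume] fun u => y u * φ u := by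
    filter_upwards [h0, ae_unitVolume_of_forall (fun u hu => hu)] with u h1 hu
    exact mul_nonneg (hy u (Ioo_subset_Ico_self hu)).le h1
  have hint : Integrable (fun u => y u * φ u) unitVolume := by
    refine (L2.integrable_inner (𝕜 := ℂ) e hφ.toLp).re.congr ?_
    filter_upwards [hey, hφ.coeFn_toLp] with u h1 h2
    rw [h1, h2, RCLike.inner_apply', Complex.conj_ofReal, ← Complex.ofReal_mul]
    exact Complex.ofReal_re _
  refine (integral_nonneg_of_ae hnn).lt_of_ne fun h => hne ?_
  filter_upwards [(integral_eq_zero_iff_of_nonneg_ae hnn hint).1 h.symm,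
    ae_unitVolume_of_forall (fun u hu => hu)] with u h1 hu
  exact (mul_eq_zero.1 h1).resolve_left (hy u (Ioo_subset_Ico_self hu)).ne'

/-- Split the initial value as `c e` plus a part orthogonal to the eigenspace, with `c = ⟪e, φ⟫ > 0`
because `y > 0`. The `L²` limit of the orbit of order `1` passes to the bounded functional
`greenAt`, giving `c y(u)`. -/
theorem IsDiffusionSolution.tendsto_exp_mul (hT : IsDiffusionSolution A φ T)
    (hρ : ∀ v ∈ Icc (0 : ℝ) 1, 0 < ρ v)
    (hA : ∀ v ∈ Icc (0 : ℝ) 1, A v * ρ v = 1)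
    (hφ : MemLp (fun u => (φ u : ℂ)) 2 unitVolume) (h0 : ∀ᵐ u ∂unitVolume, 0 ≤ φ u)
    (hne : ¬ ∀ᵐ u ∂unitVolume, φ u = 0) {u : ℝ} (hu : u ∈ Ico (0 : ℝ) 1) :
    ∃ l, 0 < l ∧ Tendsto (fun z => Real.exp (z / ‖greenOp ρ‖) * T z u) atTop (𝓝 l) := by
  obtain ⟨e, y, he1, heig, hypos, hgr, hey, hspan⟩ := exists_groundState ρ hρ
  have hμ := norm_greenOp_pos ρ hρ
  set μ := ‖greenOp ρ‖
  have hu' := Ico_subset_Icc_self hu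
  have hAc : ContinuousOn A (Icc 0 1) :=
    (ρ.continuous.continuousOn.inv₀ fun v hv => (hρ v hv).ne').congr
      fun v hv => eq_inv_of_mul_eq_one_left (hA v hv)
  set c : ℝ := ∫ u, y u * φ u ∂unitVolume
  have hc : inner ℂ e hφ.toLp = (c : ℂ) := inner_ofReal_toLp hey hφ
  refine ⟨c * y u, mul_pos (integral_mul_pos hey hypos hφ h0 hne) (hypos u hu), ?_⟩
  -- By simplicity, orthogonality to `e` alone suffices.
  have horth : ∀ k, greenOp ρ k = μ • k → inner ℂ k (hφ.toLp - (c : ℂ) • e) = 0 := by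
    intro k hk
    obtain ⟨c', rfl⟩ := hspan k hk
    have hee : inner ℂ e e = (1 : ℂ) := by
      rw [inner_self_eq_norm_sq_to_K, he1]; simp
    rw [inner_smul_left, inner_sub_right, hc, inner_smul_right, hee]
    simp
  have h1 := tendsto_exp_smul_heatOp (greenOp ρ) (greenOp_nonneg ρ hρ) hμ (c := (c : ℂ)) heig horth
  rw [add_sub_cancel] at h1
  have h2 := ((greenAt ρ ⟨u, hu'⟩).continuous.tendsto _).comp h1
  have h3 := (Complex.continuous_re.tendsto _).comp h2
  have h4 : (greenAt ρ ⟨u, hu'⟩ (μ⁻¹ • (c : ℂ) • e)).re = c * y u := by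
    rw [← ofReal_smul_unitL2, map_smul, map_smul, greenAt_apply, hgr u hu']
    simp only [smul_eq_mul, ← Complex.ofReal_mul, Complex.ofReal_re]
    field_simp
  have h5 : Tendsto (fun z => Real.exp (z / μ) * T z u) atTop
      (𝓝 (greenAt ρ ⟨u, hu'⟩ (μ⁻¹ • (c : ℂ) • e)).re) := by
    refine h3.congr' ?_
    filter_upwards [eventually_gt_atTop 0] with z hz
    have h6 := congrArg Complex.re (hT.eq_heat hρ hA hAc hφ hz hu')
    rw [Complex.ofReal_re] at h6
    rw [h6, ← Complex.re_ofReal_mul, Function.comp, Function.comp]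
    congr 1
    exact (congrArg (greenAt ρ ⟨u, hu'⟩) (ofReal_smul_unitL2 (Real.exp (z / μ))
      (heatOrbit ρ hφ.toLp 1 z)).symm).trans (map_smul _ _ _)
  rwa [h4] at h5

end Asymptotics

/-! ### The logarithmic rate and the coefficient of the theorem. -/

theorem eventually_pos_and_tendsto_log {g : ℝ → ℝ} {Λ l : ℝ} (hl : 0 < l)
    (h : Tendsto (fun z => Real.exp (z * Λ) * g z) atTop (𝓝 l)) :
    (∀ᶠ z in atTop, 0 < g z) ∧
      Tendsto (fun z => 1 / z * Real.log (g z)) atTop (𝓝 (-Λ)) := by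
  have hpos : ∀ᶠ z in atTop, 0 < g z := by
    filter_upwards [h.eventually (lt_mem_nhds hl)] with z hz
    exact pos_of_mul_pos_right hz (Real.exp_pos _).le
  refine ⟨hpos, ?_⟩
  -- The logarithm of the product tends to the finite number `log l`, so dividing by `z` sends it to
  -- `0`; removing `Λ` leaves the rate of `g`.
  have h1 := ((tendsto_inv_atTop_zero (𝕜 := ℝ)).mul (h.log hl.ne')).sub_const Λ
  rw [zero_mul, zero_sub] at h1
  refine h1.congr' ?_
  filter_upwards [hpos, eventually_gt_atTop 0] with z hg hz
  rw [Real.log_mul (Real.exp_ne_zero _) hg.ne', Real.log_exp]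
  field_simp
  ring

/-- The reciprocal of the diffusion coefficient, a polynomial. -/
def reciprocalCoeff (a d n₁ : ℝ) (γ₀ : ℝ → ℝ → ℝ) : C(ℝ, ℝ) :=
  ⟨fun u => (diffusionA₀ a d n₁ γ₀)⁻¹ *
    (1 - (1 - Real.pi ^ 2 / (a ^ 2 * d ^ 2)) * (indexTheta n₁ * u) ^ 2), by fun_prop⟩

theorem contDiff_reciprocalCoeff (a d n₁ : ℝ) (γ₀ : ℝ → ℝ → ℝ) :
    ContDiff ℝ ∞ (reciprocalCoeff a d n₁ γ₀) := by
  simp only [reciprocalCoeff, ContinuousMap.coe_mk]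
  fun_prop

theorem indexTheta_sq_mem {n₁ : ℝ} (hn₁ : 1 < n₁) : indexTheta n₁ ^ 2 ∈ Ioo (0 : ℝ) 1 := by
  have h1 : 1 < n₁ ^ 2 := by nlinarith
  have h2 : 1 / n₁ ^ 2 < 1 := by rw [div_lt_one (by linarith)]; exact h1
  have h3 : 0 < 1 / n₁ ^ 2 := by positivity
  rw [indexTheta, Real.sq_sqrt (by linarith)]
  constructor <;> linarith

theorem diffusionA₀_pos {a d n₁ : ℝ} (ha : 0 < a) (hd : 0 < d) (hn₁ : 1 < n₁)
    {γ₀ : ℝ → ℝ → ℝ} (hS₀ : 0 < spectralS₀ d γ₀) : 0 < diffusionA₀ a d n₁ γ₀ := by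
  have := (indexTheta_sq_mem hn₁).1
  have hπ := Real.pi_pos
  have hn : 0 < n₁ := by linarith
  unfold diffusionA₀
  positivity

/-- With `q = π² / (a² d²)` and `w = (θ u)² < 1`, the denominator is `(1 - w) + q w`, positive
whatever the sign of `1 - q`. -/
theorem diffusion_denominator_pos {a d n₁ u : ℝ} (ha : 0 < a) (hd : 0 < d) (hn₁ : 1 < n₁)
    (hu : u ∈ Icc (0 : ℝ) 1) :
    0 < 1 - (1 - Real.pi ^ 2 / (a ^ 2 * d ^ 2)) * (indexTheta n₁ * u) ^ 2 := by
  have h1 := indexTheta_sq_mem hn₁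
  have h2 : 0 < Real.pi ^ 2 / (a ^ 2 * d ^ 2) := by
    have := Real.pi_pos
    positivity
  have h3 : u ^ 2 ≤ 1 := pow_le_one₀ hu.1 hu.2
  have h4 : (indexTheta n₁ * u) ^ 2 < 1 := by
    rw [mul_pow]
    nlinarith [h1.1, h1.2, sq_nonneg u]
  nlinarith [sq_nonneg (indexTheta n₁ * u)]

theorem mainTheorem5 (a d n₁ : ℝ) (ha : 0 < a) (hd : 0 < d) (hn₁ : 1 < n₁)
    (γ₀ : ℝ → ℝ → ℝ) (hγ₀ : IsTransverseCovariance d γ₀) (hS₀ : 0 < spectralS₀ d γ₀) :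
    0 < decayRate (diffusionCoeff a d n₁ γ₀) ∧
    ∀ φ : ℝ → ℝ, MemLp φ 2 unitVolume → (∀ᵐ u ∂unitVolume, 0 ≤ φ u) →
      ¬ (∀ᵐ u ∂unitVolume, φ u = 0) →
      (∃ T : ℝ → ℝ → ℝ, IsDiffusionSolution (diffusionCoeff a d n₁ γ₀) φ T) ∧
      ∀ T : ℝ → ℝ → ℝ, IsDiffusionSolution (diffusionCoeff a d n₁ γ₀) φ T →
        ∀ u ∈ Set.Ico (0 : ℝ) 1,
          (∀ᶠ L : ℝ in Filter.atTop, 0 < T L u) ∧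
          Filter.Tendsto (fun L : ℝ => 1 / L * Real.log (T L u)) Filter.atTop
            (nhds (-decayRate (diffusionCoeff a d n₁ γ₀))) := by
  set ρ := reciprocalCoeff a d n₁ γ₀
  have hA₀ := diffusionA₀_pos ha hd hn₁ hS₀
  have hρ : ∀ v ∈ Icc (0 : ℝ) 1, 0 < ρ v := fun v hv =>
    mul_pos (inv_pos.2 hA₀) (diffusion_denominator_pos ha hd hn₁ hv)
  have hA : ∀ v ∈ Icc (0 : ℝ) 1, diffusionCoeff a d n₁ γ₀ v * ρ v = 1 := fun v hv => by
    have h1 := (diffusion_denominator_pos ha hd hn₁ hv).ne'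
    have h2 := hA₀.ne'
    change diffusionA₀ a d n₁ γ₀ / _ * ((diffusionA₀ a d n₁ γ₀)⁻¹ * _) = 1
    rw [div_mul_eq_mul_div, mul_inv_cancel_left₀ h2, div_self h1]
  rw [decayRate_eq ρ hρ (contDiff_reciprocalCoeff a d n₁ γ₀) hA]
  refine ⟨inv_pos.2 (norm_greenOp_pos ρ hρ), fun φ hm h0 hne => ?_⟩
  have hφ : MemLp (fun u => (φ u : ℂ)) 2 unitVolume := hm.ofReal
  refine ⟨⟨_, isDiffusionSolution_heatSolution ρ hρ hA hφ⟩, fun T hT u hu => ?_⟩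
  obtain ⟨l, hl, hlim⟩ := hT.tendsto_exp_mul hρ hA hφ h0 hne hu
  exact eventually_pos_and_tendsto_log hl (by simpa only [div_eq_mul_inv] using hlim)

end
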